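/- Let $l\ge 0$ and let $\mathbf t=(t_1,t_2,\dots,t_{2l})$ be a sequence of non-negative integers. Put $E=\sum_{i=1}^{l}t_{2i}$, $O=\sum_{i=1}^{l}t_{2i-1}$ and $s_k=t_1+\cdots+t_k$. Let $\operatorname{H}(n)=0!\,1!\,2!\cdots(n-1)!$, and let $\operatorname{H}_2(n)=0!\,2!\,4!\cdots(n-2)!$ for even $n$ and $\operatorname{H}_2(n)=1!\,3!\,5!\cdots(n-2)!$ for odd $n$; empty products are $1$, in particular $\operatorname{H}(0)=\operatorname{H}(-1)=\operatorname{H}_2(0)=\operatorname{H}_2(1)=\operatorname{H}_2(-1)=1$. On the triangular lattice with horizontal lattice lines, a lozenge is the union of two unit triangles that share an edge; it is vertical if the shared edge is horizontal. A lozenge tiling of a region is a covering of the region by lozenges without gaps or overlaps. Region $\mathcal Q(\mathbf t)$: take the trapezoidal region whose northern, northeastern and southern sides have lengths $O$, $2E$ and $E+O$, and whose western side is the vertical zigzag lattice path with $2E$ unit edges which, going up from the southwestern corner, alternates northwest and northeast steps, beginning with a northwest step. Remove from it the $l$ up-pointing triangles standing on the southern side whose bases, from left to right, are the segments from $s_{2i-1}$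 to $s_{2i}$ (measured from the southwestern corner), $i=1,\dots,l$; so the triangles have sides $t_2,t_4,\dots,t_{2l}$ and the gaps before them have lengths $t_1,t_3,\dots,t_{2l-1}$. Region $\mathcal K(\mathbf t)$: the same, with northeastern side of length $2E-1$ and with western side the vertical zigzag with $2E-1$ unit edges which, going up from the southwestern corner, begins with a northeast step (if $E=0$, $\mathcal K(\mathbf t)$ is the empty region, which has exactly one tiling). Let $\operatorname{Q}(\mathbf t)$ and $\operatorname{K}(\mathbf t)$ be the numbers of lozenge tilings of $\mathcal Q(\mathbf t)$ and $\mathcal K(\mathbf t)$. Let $\operatorname{Q}'(\mathbf t)$ and $\operatorname{K}'(\mathbf t)$ be the corresponding weighted counts, in which every vertical lozenge whose two western edges run along the western zigzag has weight $\frac12$, every other lozenge has weight $1$, the weight of a tiling is the product of the weights of its lozenges, and the weights of all tilings are added. Then \begin{align*} \operatorname{Q}(\mathbf t)&=\frac{\prod_{i=1}^{l}\frac{s_{2i}!}{s_{2i-1}!}}{\operatorname{H}_2(2E+1)}\prod_{i=1}^{l}\frac{\operatorname{H}_2(2s_{2i}+1)\operatorname{H}(2s_{2i-1}+2)}{\operatorname{H}_2(2s_{2i-1}+3)}\prod_{\substack{1\le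 i<j\le 2l\\ j-i\text{ odd}}}\frac{\operatorname{H}(s_j-s_i)}{\operatorname{H}(s_j+s_i+1)}\prod_{\substack{1\le i<j\le 2l\\ j-i\text{ even}}}\frac{\operatorname{H}(s_j+s_i+1)}{\operatorname{H}(s_j-s_i)},\\ \operatorname{Q}'(\mathbf t)&=\frac{2^{-E}}{\operatorname{H}_2(2E+1)}\prod_{i=1}^{l}\frac{\operatorname{H}_2(2s_{2i}+1)\operatorname{H}(2s_{2i-1})}{\operatorname{H}_2(2s_{2i-1}+1)}\prod_{\substack{1\le i<j\le 2l\\ j-i\text{ odd}}}\frac{\operatorname{H}(s_j-s_i)}{\operatorname{H}(s_j+s_i)}\prod_{\substack{1\le i<j\le 2l\\ j-i\text{ even}}}\frac{\operatorname{H}(s_j+s_i)}{\operatorname{H}(s_j-s_i)},\\ \operatorname{K}(\mathbf t)&=\frac{1}{\operatorname{H}_2(2E)}\prod_{i=1}^{l}\frac{\operatorname{H}_2(2s_{2i})\operatorname{H}(2s_{2i-1}+1)}{\operatorname{H}_2(2s_{2i-1}+2)}\prod_{\substack{1\le i<j\le 2l\\ j-i\text{ odd}}}\frac{\operatorname{H}(s_j-s_i)}{\operatorname{H}(s_j+s_i)}\prod_{\substack{1\le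 i<j\le 2l\\ j-i\text{ even}}}\frac{\operatorname{H}(s_j+s_i)}{\operatorname{H}(s_j-s_i)},\\ \operatorname{K}'(\mathbf t)&=\frac{1}{\operatorname{H}_2(2E)}\prod_{i=1}^{l}\frac{\operatorname{H}_2(2s_{2i}-1)\operatorname{H}(2s_{2i-1})}{\operatorname{H}_2(2s_{2i-1}+1)}\prod_{\substack{1\le i<j\le 2l\\ j-i\text{ odd}}}\frac{\operatorname{H}(s_j-s_i)}{\operatorname{H}(s_j+s_i-1)}\prod_{\substack{1\le i<j\le 2l\\ j-i\text{ even}}}\frac{\operatorname{H}(s_j+s_i-1)}{\operatorname{H}(s_j-s_i)}. \end{align*} -/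

import Mathlib

namespace QuarteredHexagon

open Finset

noncomputable section

/-! The triangular lattice.  The pair `(x, y) : ℤ × ℤ` stands for the lattice point
`x • (1, 0) + y • (1/2, √3/2)` of the plane. -/

/-- A unit triangle of the triangular lattice: `(x, y, true)` is the up-pointing triangle whose
horizontal (bottom) side joins `(x, y)` and `(x + 1, y)`, and `(x, y, false)` is the down-pointing
triangle whose horizontal (top) side joins `(x, y + 1)` and `(x + 1, y + 1)`. -/
abbrev Tri := ℤ × ℤ × Bool

/-- The three lattice points that are the vertices of a unit triangle. -/
def verts : Tri → Finset (ℤ × ℤ)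
  | (x, y, true) => {(x, y), (x + 1, y), (x, y + 1)}
  | (x, y, false) => {(x + 1, y), (x, y + 1), (x + 1, y + 1)}

/-- Two unit triangles share an edge: they have exactly two vertices in common. -/
def ShareEdge (p q : Tri) : Prop := #(verts p ∩ verts q) = 2

instance (p q : Tri) : Decidable (ShareEdge p q) := by unfold ShareEdge; infer_instance

/-- The lozenges contained in a finite region `R` (a finite set of unit triangles): the unions of
two unit triangles of `R` that share an edge. -/
def lozenges (R : Finset Tri) : Finset (Finset Tri) :=
  {p ∈ R ×ˢ R | ShareEdge p.1 p.2}.image fun p => {p.1, p.2}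

/-- The lozenge tilings of `R`: sets of lozenges in `R` without overlaps and without gaps. -/
def tilings (R : Finset Tri) : Finset (Finset (Finset Tri)) :=
  {T ∈ (lozenges R).powerset |
    (∀ a ∈ T, ∀ b ∈ T, a ≠ b → Disjoint a b) ∧ T.biUnion id = R}

/-- The sum of the weights of all tilings of `R`; the weight of a tiling is the product of the
weights of its lozenges. -/
def weightedCount (w : Finset Tri → ℚ) (R : Finset Tri) : ℚ :=
  ∑ T ∈ tilings R, ∏ a ∈ T, w a

/-- The trapezoidal region of height `m` (in rows of unit triangles), with southern side from
`(0, 0)` to `(N, 0)`, with straight northeastern side from `(N, 0)` to `(N - m, m)`, and with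
western side the lattice path through the points `(west y, y)`, `0 ≤ y ≤ m`.
A unit triangle lies in a single row, so it lies in the region iff its vertices do.
(The first coordinates of the triangles are searched in `[-m, N]`, which is enough
for the two western sides below.) -/
def trapezoid (west : ℤ → ℤ) (m N : ℕ) : Finset Tri :=
  {p ∈ Icc (-(m : ℤ)) N ×ˢ Ico (0 : ℤ) m ×ˢ (univ : Finset Bool) |
    ∀ v ∈ verts p, 0 ≤ v.2 ∧ v.2 ≤ m ∧ v.1 + v.2 ≤ N ∧ west v.2 ≤ v.1}

/-- A unit triangle lies in the up-pointing triangle of side `k` whose base joins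
`(a, 0)` and `(a + k, 0)`. -/
def InBaseTriangle (a k : ℕ) (p : Tri) : Prop :=
  ∀ v ∈ verts p, 0 ≤ v.2 ∧ (a : ℤ) ≤ v.1 ∧ v.1 + v.2 ≤ (a : ℤ) + k

instance (a k : ℕ) (p : Tri) : Decidable (InBaseTriangle a k p) := by
  unfold InBaseTriangle; infer_instance

/-- The vertical zigzag that starts at `(0, 0)` with a step to the northwest:
at height `y` its horizontal position in the plane is `0` for even `y` and `-1/2` for odd `y`. -/
def westQ (y : ℤ) : ℤ := -((y + 1) / 2)

/-- The vertical zigzag that starts at `(0, 0)` with a step to the northeast: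
at height `y` its horizontal position in the plane is `0` for even `y` and `1/2` for odd `y`. -/
def westK (y : ℤ) : ℤ := -(y / 2)

/-- The vertical lozenges on the western side have weight `1/2`, all other lozenges weight `1`.
The vertical lozenge with western vertex `(west y, y)` is on the western side if its two western
edges run along the zigzag, i.e. if the zigzag passes through `(west y + 1, y - 1)`,
`(west y, y)` and `(west y, y + 1)`. -/
def westWeight (west : ℤ → ℤ) (m : ℕ) (a : Finset Tri) : ℚ :=
  if ∃ y ∈ Ioo (0 : ℤ) m, west (y - 1) = west y + 1 ∧ west (y + 1) = west y ∧
      a = {(west y, y - 1, false), (west y, y, true)}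
  then 1 / 2 else 1

section Sequences

variable {l : ℕ} (t : Fin (2 * l) → ℕ)

/-- The entry `t_{j+1}` of `t = (t_1, …, t_{2l})` is `t j`; this is the partial sum
`s_k = t_1 + ⋯ + t_k`. -/
def psum (k : ℕ) : ℕ := ∑ j with j.val < k, t j

/-- `t_2 + t_4 + ⋯ + t_{2l}` -/
def evenSum : ℕ := ∑ i : Fin l, t ⟨2 * i.val + 1, by omega⟩

/-- `t_1 + t_3 + ⋯ + t_{2l-1}` -/
def oddSum : ℕ := ∑ i : Fin l, t ⟨2 * i.val, by omega⟩

/-- Remove from `R` the up-pointing triangles of sides `t_2, t_4, …, t_{2l}` standing on the base,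
from left to right, where the gap before the triangle of side `t_{2i}` has length `t_{2i-1}`. -/
def removeTriangles (R : Finset Tri) : Finset Tri :=
  {p ∈ R | ∀ i : Fin l,
    ¬ InBaseTriangle (psum t (2 * i.val + 1)) (t ⟨2 * i.val + 1, by omega⟩) p}

/-- The region `𝒬(t)`: southern side `E + O`, northeastern side `2E`, northern side `O`. -/
def regionQ : Finset Tri :=
  removeTriangles t (trapezoid westQ (2 * evenSum t) (evenSum t + oddSum t))

/-- The region `𝒦(t)`: southern side `E + O`, northeastern side `2E - 1`, northern side `O`
(the empty region if `E = 0`). -/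
def regionK : Finset Tri :=
  removeTriangles t (trapezoid westK (2 * evenSum t - 1) (evenSum t + oddSum t))

/-- The number of lozenge tilings of `𝒬(t)`. -/
def tilingsQ : ℕ := #(tilings (regionQ t))

/-- The weighted number of lozenge tilings of `𝒬'(t)`. -/
def weightedTilingsQ : ℚ := weightedCount (westWeight westQ (2 * evenSum t)) (regionQ t)

/-- The number of lozenge tilings of `𝒦(t)`. -/
def tilingsK : ℕ := #(tilings (regionK t))

/-- The weighted number of lozenge tilings of `𝒦'(t)`. -/
def weightedTilingsK : ℚ := weightedCount (westWeight westK (2 * evenSum t - 1)) (regionK t)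

end Sequences

/-- The hyperfactorial `H(n) = 0! 1! ⋯ (n-1)!`. -/
def hyper (n : ℕ) : ℕ := ∏ i ∈ range n, i.factorial

/-- The skipping hyperfactorial: `0! 2! 4! ⋯ (n-2)!` for even `n`, `1! 3! 5! ⋯ (n-2)!` for odd
`n`. -/
def hyperSkip (n : ℕ) : ℕ := ∏ i ∈ range (n / 2), (2 * i + n % 2).factorial

/-- The pairs `(i, j)` with `1 ≤ i < j ≤ n` and `j - i` odd. -/
def oddPairs (n : ℕ) : Finset (ℕ × ℕ) :=
  {p ∈ Icc 1 n ×ˢ Icc 1 n | p.1 < p.2 ∧ Odd (p.2 - p.1)}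

/-- The pairs `(i, j)` with `1 ≤ i < j ≤ n` and `j - i` even. -/
def evenPairs (n : ℕ) : Finset (ℕ × ℕ) :=
  {p ∈ Icc 1 n ×ˢ Icc 1 n | p.1 < p.2 ∧ Even (p.2 - p.1)}

end

end QuarteredHexagon

namespace QuarteredHexagon

open Finset

/-! ### Lozenges and tilings -/

/-! Inside each removed big triangle, putting everything back except the unit triangles on its base
changes no count, because the restored part has only one tiling, by vertical lozenges
(`weightedCount_removeTriangles`). What remains is a trapezoid with dents at the positions `blocks
(psum t) l` of its base. In cell coordinates both zigzags become the line `c = 0`; the two families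
differ only in the parity of the first row.

A tiling of a dented row is determined by its vertical lozenges. They occupy one position between
consecutive dents, and one more to the left of the first dent if the row starts with a down-pointing
cell. Their upper halves are the dents of the next row, so the count is an iterated sum over
interlacing sequences (`IsCellCount.row_transfer`).

This sum stays a determinant from row to row. If the count from the next row on is a constant times
`det (P_j (b_i + σ))`, multilinearity moves the sum over `b_i` into row `i`. There it telescopes,
since the central differences of `evenPoly` and `oddPoly` are multiples of each other. Rows become
differences of consecutive rows, which a row operation undoes. On the western side the lower end of
the telescoping sum has to vanish: this happens for `σ = 1` without weights and for `σ = 0` with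
weight `1/2` (`IsBoundaryWeight`). The induction is `closed_form_odd` and `closed_form_even`.

Both determinants are Vandermonde determinants in the squares `x_i ^ 2`, up to the factor `∏ x_i` in
the odd case. With `x_i = 2 n_i + τ` they give products of `(n_j - n_i) (n_j + n_i + τ)` over pairs
of dents. Since the dents form intervals, these products telescope to hyperfactorials of the ends
(`IsProductData.endsProd_eq_pairProd`). The four formulas are the four choices of region and weight.
-/

theorem mem_verts_up {x y : ℤ} {v : ℤ × ℤ} :
    v ∈ verts (x, y, true) ↔ v = (x, y) ∨ v = (x + 1, y) ∨ v = (x, y + 1) := by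
  simp [verts]

theorem mem_verts_down {x y : ℤ} {v : ℤ × ℤ} :
    v ∈ verts (x, y, false) ↔ v = (x + 1, y) ∨ v = (x, y + 1) ∨ v = (x + 1, y + 1) := by
  simp [verts]

theorem ShareEdge.symm {p q : Tri} (h : ShareEdge p q) : ShareEdge q p := by
  unfold ShareEdge at *; rwa [inter_comm]

theorem not_shareEdge_up_up (x y x' y' : ℤ) : ¬ ShareEdge (x, y, true) (x', y', true) := by
  intro h
  by_cases hx : x = x' ∧ y = y'
  · obtain ⟨rfl, rfl⟩ := hx
    have : #(verts (x, y, true)) = 3 := by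
      simp only [verts]
      rw [card_insert_of_notMem (by simp), card_insert_of_notMem (by simp), card_singleton]
    unfold ShareEdge at h
    rw [inter_self] at h
    omega
  · obtain ⟨⟨u1, u2⟩, ⟨w1, w2⟩, hne, he⟩ := card_eq_two.1 h
    have hu : (u1, u2) ∈ verts (x, y, true) ∩ verts (x', y', true) := by simp [he]
    have hw : (w1, w2) ∈ verts (x, y, true) ∩ verts (x', y', true) := by simp [he]
    simp only [mem_inter, mem_verts_up, Prod.mk.injEq] at hu hw
    simp only [ne_eq, Prod.mk.injEq] at hne
    omega

theorem not_shareEdge_down_down (x y x' y' : ℤ) :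
    ¬ ShareEdge (x, y, false) (x', y', false) := by
  intro h
  by_cases hx : x = x' ∧ y = y'
  · obtain ⟨rfl, rfl⟩ := hx
    have : #(verts (x, y, false)) = 3 := by
      simp only [verts]
      rw [card_insert_of_notMem (by simp), card_insert_of_notMem (by simp), card_singleton]
    unfold ShareEdge at h
    rw [inter_self] at h
    omega
  · obtain ⟨⟨u1, u2⟩, ⟨w1, w2⟩, hne, he⟩ := card_eq_two.1 h
    have hu : (u1, u2) ∈ verts (x, y, false) ∩ verts (x', y', false) := by simp [he]
    have hw : (w1, w2) ∈ verts (x, y, false) ∩ verts (x', y', false) := by simp [he]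
    simp only [mem_inter, mem_verts_down, Prod.mk.injEq] at hu hw
    simp only [ne_eq, Prod.mk.injEq] at hne
    omega

theorem shareEdge_up_down {x y x' y' : ℤ} :
    ShareEdge (x, y, true) (x', y', false) ↔
      (x' = x ∧ y' = y) ∨ (x' = x - 1 ∧ y' = y) ∨ (x' = x ∧ y' = y - 1) := by
  constructor
  · intro h
    obtain ⟨⟨u1, u2⟩, ⟨w1, w2⟩, hne, he⟩ := card_eq_two.1 h
    have hu : (u1, u2) ∈ verts (x, y, true) ∩ verts (x', y', false) := by simp [he]
    have hw : (w1, w2) ∈ verts (x, y, true) ∩ verts (x', y', false) := by simp [he]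
    simp only [mem_inter, mem_verts_up, mem_verts_down, Prod.mk.injEq] at hu hw
    simp only [ne_eq, Prod.mk.injEq] at hne
    omega
  · intro h
    refine card_eq_two.2 ?_
    rcases h with ⟨rfl, rfl⟩ | ⟨rfl, rfl⟩ | ⟨rfl, rfl⟩
    · refine ⟨(x' + 1, y'), (x', y' + 1), by simp, ?_⟩
      ext ⟨a, b⟩
      simp only [mem_inter, mem_verts_up, mem_verts_down, mem_insert, mem_singleton,
        Prod.mk.injEq]
      omega
    · refine ⟨(x, y'), (x, y' + 1), by simp, ?_⟩
      ext ⟨a, b⟩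
      simp only [mem_inter, mem_verts_up, mem_verts_down, mem_insert, mem_singleton,
        Prod.mk.injEq]
      omega
    · refine ⟨(x', y), (x' + 1, y), by simp, ?_⟩
      ext ⟨a, b⟩
      simp only [mem_inter, mem_verts_up, mem_verts_down, mem_insert, mem_singleton,
        Prod.mk.injEq]
      omega

theorem shareEdge_down_up {x y x' y' : ℤ} :
    ShareEdge (x, y, false) (x', y', true) ↔
      (x' = x ∧ y' = y) ∨ (x' = x + 1 ∧ y' = y) ∨ (x' = x ∧ y' = y + 1) := by
  rw [show ShareEdge (x, y, false) (x', y', true) ↔ ShareEdge (x', y', true) (x, y, false) from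
    ⟨ShareEdge.symm, ShareEdge.symm⟩, shareEdge_up_down]
  omega

theorem ShareEdge.ne {p q : Tri} (h : ShareEdge p q) : p ≠ q := by
  rintro rfl
  obtain ⟨x, y, b⟩ := p
  cases b
  · exact not_shareEdge_down_down _ _ _ _ h
  · exact not_shareEdge_up_up _ _ _ _ h

theorem mem_lozenges {R a : Finset Tri} :
    a ∈ lozenges R ↔ ∃ p ∈ R, ∃ q ∈ R, ShareEdge p q ∧ a = {p, q} := by
  simp only [lozenges, mem_image, mem_filter, mem_product]
  constructor
  · rintro ⟨⟨p, q⟩, ⟨⟨hp, hq⟩, h⟩, rfl⟩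
    exact ⟨p, hp, q, hq, h, rfl⟩
  · rintro ⟨p, hp, q, hq, h, rfl⟩
    exact ⟨(p, q), ⟨⟨hp, hq⟩, h⟩, rfl⟩

theorem mem_tilings {R : Finset Tri} {T : Finset (Finset Tri)} :
    T ∈ tilings R ↔ (∀ a ∈ T, a ∈ lozenges R) ∧ (∀ a ∈ T, ∀ b ∈ T, a ≠ b → Disjoint a b) ∧
      T.biUnion id = R := by
  simp only [tilings, mem_filter, mem_powerset, subset_iff]

theorem subset_of_mem_lozenges {R a : Finset Tri} (h : a ∈ lozenges R) : a ⊆ R := by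
  obtain ⟨p, hp, q, hq, -, rfl⟩ := mem_lozenges.1 h
  simp [insert_subset_iff, hp, hq]

theorem erase_mem_tilings {R L : Finset Tri} {T : Finset (Finset Tri)} (hT : T ∈ tilings R)
    (hL : L ∈ T) : T.erase L ∈ tilings (R \ L) := by
  obtain ⟨h1, h2, h3⟩ := mem_tilings.1 hT
  refine mem_tilings.2 ⟨fun a ha => ?_, fun a ha b hb => h2 a (mem_of_mem_erase ha) b
    (mem_of_mem_erase hb), ?_⟩
  · obtain ⟨hne, ha⟩ := mem_erase.1 ha
    have hd := h2 a ha L hL hne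
    obtain ⟨p, hp, q, hq, hpq, rfl⟩ := mem_lozenges.1 (h1 a ha)
    rw [disjoint_left] at hd
    exact mem_lozenges.2 ⟨p, mem_sdiff.2 ⟨hp, hd (by simp)⟩, q, mem_sdiff.2 ⟨hq, hd (by simp)⟩,
      hpq, rfl⟩
  · ext x
    rw [← h3]
    simp only [mem_biUnion, mem_erase, id, mem_sdiff]
    constructor
    · rintro ⟨a, ⟨hne, ha⟩, hx⟩
      exact ⟨⟨a, ha, hx⟩, disjoint_left.1 (h2 a ha L hL hne) hx⟩
    · rintro ⟨⟨a, ha, hx⟩, hxL⟩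
      exact ⟨a, ⟨fun h => hxL (h ▸ hx), ha⟩, hx⟩

theorem insert_mem_tilings {R L : Finset Tri} {T : Finset (Finset Tri)} (hL : L ∈ lozenges R)
    (hT : T ∈ tilings (R \ L)) : L ∉ T ∧ insert L T ∈ tilings R := by
  obtain ⟨h1, h2, h3⟩ := mem_tilings.1 hT
  have hLR := subset_of_mem_lozenges hL
  have hd : ∀ a ∈ T, Disjoint a L := fun a ha =>
    disjoint_of_subset_left (subset_of_mem_lozenges (h1 a ha)) sdiff_disjoint
  have hne : L.Nonempty := by
    obtain ⟨p, hp, q, hq, -, rfl⟩ := mem_lozenges.1 hL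
    simp
  refine ⟨fun h => hne.ne_empty (disjoint_self_iff_empty _ |>.1 (hd L h)), mem_tilings.2
    ⟨fun a ha => ?_, fun a ha b hb hab => ?_, ?_⟩⟩
  · rcases mem_insert.1 ha with rfl | ha
    · exact hL
    · obtain ⟨p, hp, q, hq, hpq, rfl⟩ := mem_lozenges.1 (h1 a ha)
      exact mem_lozenges.2 ⟨p, (mem_sdiff.1 hp).1, q, (mem_sdiff.1 hq).1, hpq, rfl⟩
  · rcases mem_insert.1 ha with haL | haT <;> rcases mem_insert.1 hb with hbL | hbT
    · exact absurd (haL.trans hbL.symm) hab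
    · exact haL ▸ (hd b hbT).symm
    · exact hbL ▸ hd a haT
    · exact h2 a haT b hbT hab
  · rw [biUnion_insert, h3, id, union_sdiff_of_subset hLR]

/-! ### Weighted counts: expansion along a triangle and forced lozenges. -/

theorem weightedCount_empty (w : Finset Tri → ℚ) : weightedCount w ∅ = 1 := by
  have : tilings ∅ = {∅} := by
    ext T
    rw [mem_tilings, mem_singleton]
    constructor
    · rintro ⟨h, -⟩
      refine eq_empty_of_forall_notMem fun a ha => ?_
      obtain ⟨p, hp, -⟩ := mem_lozenges.1 (h a ha)
      simp at hp
    · rintro rfl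
      simp
  simp [weightedCount, this]

/-- Expansion of the weighted number of tilings along the lozenge that covers a given triangle. -/
theorem weightedCount_eq_sum (w : Finset Tri → ℚ) {R : Finset Tri} {p : Tri} (hp : p ∈ R) :
    weightedCount w R =
      ∑ q ∈ R with ShareEdge p q, w {p, q} * weightedCount w (R \ {p, q}) := by
  have key : ∀ q ∈ ({q ∈ R | ShareEdge p q} : Finset Tri),
      w {p, q} * weightedCount w (R \ {p, q}) =
        ∑ T ∈ tilings R with {p, q} ∈ T, ∏ a ∈ T, w a := by
    intro q hq
    obtain ⟨hq, hpq⟩ := mem_filter.1 hq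
    have hL : ({p, q} : Finset Tri) ∈ lozenges R := mem_lozenges.2 ⟨p, hp, q, hq, hpq, rfl⟩
    rw [weightedCount, mul_sum]
    refine sum_bij' (fun T _ => insert {p, q} T) (fun T _ => T.erase {p, q}) ?_ ?_ ?_ ?_ ?_
    · intro T hT
      exact mem_filter.2 ⟨(insert_mem_tilings hL hT).2, mem_insert_self _ _⟩
    · intro T hT
      exact erase_mem_tilings (mem_filter.1 hT).1 (mem_filter.1 hT).2
    · intro T hT
      exact erase_insert (insert_mem_tilings hL hT).1
    · intro T hT
      exact insert_erase (mem_filter.1 hT).2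
    · intro T hT
      rw [prod_insert (insert_mem_tilings hL hT).1]
  rw [sum_congr rfl key, weightedCount]
  simp_rw [sum_filter (s := tilings R)]
  -- After the interchange it remains to see that each tiling is counted once: exactly one of its
  -- lozenges contains `p`, by covering and disjointness.
  rw [sum_comm]
  refine sum_congr rfl fun T hT => ?_
  obtain ⟨h1, h2, h3⟩ := mem_tilings.1 hT
  obtain ⟨a, ha, hpa⟩ : ∃ a ∈ T, p ∈ a := by
    have := h3.symm ▸ hp
    simpa using this
  obtain ⟨q, hq, hpq, rfl⟩ : ∃ q ∈ R, ShareEdge p q ∧ a = {p, q} := by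
    obtain ⟨r, hr, s, hs, hrs, rfl⟩ := mem_lozenges.1 (h1 a ha)
    rcases mem_insert.1 hpa with rfl | h
    · exact ⟨s, hs, hrs, rfl⟩
    · obtain rfl := mem_singleton.1 h
      exact ⟨r, hr, hrs.symm, pair_comm _ _⟩
  rw [sum_eq_single q, if_pos ha]
  · intro q' hq' hne
    refine if_neg fun h => hne ?_
    by_contra hqq
    have hne' : ({p, q'} : Finset Tri) ≠ {p, q} := by
      intro he
      have : q' ∈ ({p, q} : Finset Tri) := by rw [← he]; simp
      rcases mem_insert.1 this with h | h
      · exact (mem_filter.1 hq').2.ne h.symm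
      · exact hne (mem_singleton.1 h)
    exact disjoint_left.1 (h2 _ h _ ha hne') (mem_insert_self p _) (mem_insert_self p _)
  · intro h
    exact absurd (mem_filter.2 ⟨hq, hpq⟩) h

theorem card_tilings_eq_weightedCount (R : Finset Tri) :
    (#(tilings R) : ℚ) = weightedCount (fun _ => 1) R := by
  simp [weightedCount]

/-- Forced lozenges: each triangle `p ∈ X` is matched to `f p`, since its other neighbours in `R`
are matched to triangles of `X` in lower rows. -/
theorem weightedCount_forced (w : Finset Tri → ℚ) (f : Tri → Tri) (hf : Function.Injective f)
    (X : Finset Tri) : ∀ R : Finset Tri, X ⊆ R → X.image f ⊆ R → Disjoint X (X.image f) →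
    (∀ p ∈ X, ShareEdge p (f p)) → (∀ p ∈ X, w {p, f p} = 1) →
    (∀ p ∈ X, ∀ q ∈ R, ShareEdge p q → q ≠ f p → ∃ p' ∈ X, p'.2.1 < p.2.1 ∧ q = f p') →
    weightedCount w R = weightedCount w (R \ (X ∪ X.image f)) := by
  induction hn : #X generalizing X with
  | zero =>
    intro R
    rw [card_eq_zero] at hn
    simp [hn]
  | succ n ih =>
    intro R hX hfX hd hs hw hforce
    have hne : X.Nonempty := card_pos.1 (by omega)
    -- In the lowest row of `X` no competing neighbour can exist, as it would be the partner of a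
    -- triangle of `X` in a still lower row. So `f p` is the only choice for `p`.
    obtain ⟨p, hp, hmin⟩ := exists_min_image X (fun p => p.2.1) hne
    have hfp : f p ∈ R := hfX (mem_image_of_mem f hp)
    have hnb : ({q ∈ R | ShareEdge p q} : Finset Tri) = {f p} := by
      ext q
      rw [mem_filter, mem_singleton]
      constructor
      · rintro ⟨hq, hpq⟩
        by_contra hqf
        obtain ⟨p', hp', hlt, -⟩ := hforce p hp q hq hpq hqf
        exact absurd (hmin p' hp') (not_le.2 hlt)
      · rintro rfl
        exact ⟨hfp, hs p hp⟩
    have hpf : ∀ r ∈ X, ∀ r' ∈ X, r ≠ f r' := fun r hr r' hr' h =>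
      disjoint_left.1 hd hr (h ▸ mem_image_of_mem f hr')
    rw [weightedCount_eq_sum w (hX hp), hnb, sum_singleton, hw p hp, one_mul,
      ih (X.erase p) (by rw [card_erase_of_mem hp]; omega)]
    · congr 1
      ext q
      simp only [mem_sdiff, mem_union, mem_image, mem_erase, mem_insert, mem_singleton]
      constructor
      · rintro ⟨⟨hq, h1⟩, h2⟩
        refine ⟨hq, ?_⟩
        rintro (h | ⟨r, hr, rfl⟩)
        · exact h2 (Or.inl ⟨fun h' => h1 (Or.inl h'), h⟩)
        · exact h2 (Or.inr ⟨r, ⟨fun h' => h1 (Or.inr (h' ▸ rfl)), hr⟩, rfl⟩)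
      · rintro ⟨hq, h⟩
        refine ⟨⟨hq, ?_⟩, ?_⟩
        · rintro (rfl | rfl)
          · exact h (Or.inl hp)
          · exact h (Or.inr ⟨p, hp, rfl⟩)
        · rintro (⟨-, h'⟩ | ⟨r, ⟨-, hr⟩, rfl⟩)
          · exact h (Or.inl h')
          · exact h (Or.inr ⟨r, hr, rfl⟩)
    · intro r hr
      obtain ⟨hne, hr⟩ := mem_erase.1 hr
      simp [hX hr, hne, hpf r hr p hp]
    · intro r hr
      obtain ⟨r, hr', rfl⟩ := mem_image.1 hr
      obtain ⟨hne, hr'⟩ := mem_erase.1 hr'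
      simp [hfX (mem_image_of_mem f hr'), (hpf p hp r hr').symm, hf.ne hne]
    · exact disjoint_of_subset_left (erase_subset _ _)
        (disjoint_of_subset_right (image_subset_image (erase_subset _ _)) hd)
    · exact fun r hr => hs r (mem_of_mem_erase hr)
    · exact fun r hr => hw r (mem_of_mem_erase hr)
    · intro r hr q hq hrq hqf
      obtain ⟨hq, hq'⟩ := mem_sdiff.1 hq
      obtain ⟨p', hp', hlt, rfl⟩ := hforce r (mem_of_mem_erase hr) q hq hrq hqf
      refine ⟨p', mem_erase.2 ⟨?_, hp'⟩, hlt, rfl⟩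
      rintro rfl
      simp at hq'

/-! ### Transfer from one row to the next

The unit triangles are indexed by cells `(c, y)`, where `y` is the row and `c` is twice the
horizontal position of the centre: the up-pointing triangles are the cells with `c - y` odd, the
down-pointing ones those with `c - y` even. -/

/-- `W` behaves like a weighted tiling count on finite sets of cells, where `v c y` is the weight
of the vertical lozenge made of the cells `(c, y)` and `(c, y + 1)`, and the other lozenges have
weight `1`. Only expansions along the leftmost cell of the lowest row are required. -/
structure IsCellCount (W : Finset (ℤ × ℤ) → ℚ) (v : ℤ → ℤ → ℚ) : Prop where
  empty : W ∅ = 1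
  up : ∀ (R : Finset (ℤ × ℤ)) (c y : ℤ), (c, y) ∈ R → Odd (c - y) → (c - 1, y) ∉ R →
    (c, y - 1) ∉ R → W R = if (c + 1, y) ∈ R then W (R \ {(c, y), (c + 1, y)}) else 0
  down : ∀ (R : Finset (ℤ × ℤ)) (c y : ℤ), (c, y) ∈ R → Even (c - y) → (c - 1, y) ∉ R →
    W R = (if (c + 1, y) ∈ R then W (R \ {(c, y), (c + 1, y)}) else 0) +
      (if (c, y + 1) ∈ R then v c y * W (R \ {(c, y), (c, y + 1)}) else 0)

/-- The cells of a trapezoid in the rows from `y` to `m - 1`, without the cells of row `y` that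
are left of `c` or in `A`, and without the cells of row `y + 1` in `U`. -/
noncomputable def rowState (N m y c : ℤ) (A U : Finset ℤ) : Finset (ℤ × ℤ) :=
  {p ∈ Icc 0 (2 * N - y) ×ˢ Ico y m |
    p.1 < 2 * N - p.2 ∧ (p.2 = y → c ≤ p.1 ∧ p.1 ∉ A) ∧ (p.2 = y + 1 → p.1 ∉ U)}

theorem mem_rowState {N m y c : ℤ} {A U : Finset ℤ} {p : ℤ × ℤ} :
    p ∈ rowState N m y c A U ↔ 0 ≤ p.1 ∧ y ≤ p.2 ∧ p.2 < m ∧ p.1 < 2 * N - p.2 ∧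
      (p.2 = y → c ≤ p.1 ∧ p.1 ∉ A) ∧ (p.2 = y + 1 → p.1 ∉ U) := by
  simp only [rowState, mem_filter, mem_product, mem_Icc, mem_Ico]
  constructor
  · rintro ⟨⟨⟨h1, h2⟩, h3, h4⟩, h5, h6, h7⟩
    exact ⟨h1, h3, h4, h5, h6, h7⟩
  · rintro ⟨h1, h3, h4, h5, h6, h7⟩
    exact ⟨⟨⟨h1, by omega⟩, h3, h4⟩, h5, h6, h7⟩

/-- The cells of a trapezoid in the rows from `y` to `m - 1` without the cells of row `y` in
`A`. -/
noncomputable def dentedRegion (N m y : ℤ) (A : Finset ℤ) : Finset (ℤ × ℤ) := rowState N m y 0 A ∅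

theorem rowState_eq_dentedRegion {N m y c : ℤ} {A U : Finset ℤ} (hc : 2 * N - y ≤ c) :
    rowState N m y c A U = dentedRegion N m (y + 1) U := by
  ext ⟨a, b⟩
  simp only [dentedRegion, mem_rowState, notMem_empty]
  constructor
  · rintro ⟨h1, h2, h3, h4, h5, h6⟩
    have : b ≠ y := fun h => by have := (h5 h).1; omega
    exact ⟨h1, by omega, h3, h4, fun h => ⟨h1, h6 h⟩, by simp⟩
  · rintro ⟨h1, h2, h3, h4, h5, -⟩
    exact ⟨h1, by omega, h3, h4, by omega, fun h => (h5 h).2⟩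

theorem rowState_congr {N m y c c' : ℤ} {A A' U : Finset ℤ}
    (h : ∀ d, 0 ≤ d → ((c ≤ d ∧ d ∉ A) ↔ (c' ≤ d ∧ d ∉ A'))) :
    rowState N m y c A U = rowState N m y c' A' U := by
  ext ⟨a, b⟩
  simp only [mem_rowState]
  constructor
  · rintro ⟨h1, h2, h3, h4, h5, h6⟩
    exact ⟨h1, h2, h3, h4, fun hb => (h a h1).1 (h5 hb), h6⟩
  · rintro ⟨h1, h2, h3, h4, h5, h6⟩
    exact ⟨h1, h2, h3, h4, fun hb => (h a h1).2 (h5 hb), h6⟩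

theorem rowState_sdiff_horizontal {N m y c : ℤ} {A U : Finset ℤ} :
    rowState N m y c A U \ {(c, y), (c + 1, y)} = rowState N m y (c + 2) A U := by
  ext ⟨a, b⟩
  simp only [mem_sdiff, mem_rowState, mem_insert, mem_singleton, Prod.mk.injEq]
  constructor
  · rintro ⟨⟨h1, h2, h3, h4, h5, h6⟩, h7⟩
    exact ⟨h1, h2, h3, h4, fun hb => ⟨by have := (h5 hb).1; omega, (h5 hb).2⟩, h6⟩
  · rintro ⟨h1, h2, h3, h4, h5, h6⟩
    refine ⟨⟨h1, h2, h3, h4, fun hb => ⟨by have := (h5 hb).1; omega, (h5 hb).2⟩, h6⟩, ?_⟩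
    rintro (⟨h, hb⟩ | ⟨h, hb⟩) <;> have := (h5 hb).1 <;> omega

theorem rowState_sdiff_vertical {N m y c : ℤ} {A U : Finset ℤ} :
    rowState N m y c A U \ {(c, y), (c, y + 1)} = rowState N m y (c + 1) A (insert c U) := by
  ext ⟨a, b⟩
  simp only [mem_sdiff, mem_rowState, mem_insert, mem_singleton, Prod.mk.injEq]
  constructor
  · rintro ⟨⟨h1, h2, h3, h4, h5, h6⟩, h7⟩
    refine ⟨h1, h2, h3, h4, fun hb => ⟨by have := (h5 hb).1; omega, (h5 hb).2⟩, fun hb => ?_⟩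
    rintro (h | h)
    · exact h7 (Or.inr ⟨h, hb⟩)
    · exact h6 hb h
  · rintro ⟨h1, h2, h3, h4, h5, h6⟩
    refine ⟨⟨h1, h2, h3, h4, fun hb => ⟨by have := (h5 hb).1; omega, (h5 hb).2⟩,
      fun hb h => h6 hb (Or.inr h)⟩, ?_⟩
    rintro (⟨h, hb⟩ | ⟨h, hb⟩)
    · have := (h5 hb).1; omega
    · exact h6 hb (Or.inl h)

theorem mem_rowState_row {N m y c d : ℤ} {A U : Finset ℤ} :
    (d, y) ∈ rowState N m y c A U ↔ 0 ≤ d ∧ y < m ∧ d < 2 * N - y ∧ c ≤ d ∧ d ∉ A := by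
  simp [mem_rowState]

theorem mem_rowState_row_succ {N m y c d : ℤ} {A U : Finset ℤ} :
    (d, y + 1) ∈ rowState N m y c A U ↔ 0 ≤ d ∧ y + 1 < m ∧ d < 2 * N - (y + 1) ∧ d ∉ U := by
  simp [mem_rowState]

/-- The integers `b` with `c ≤ b < a` and `b - c` even. -/
noncomputable def evenSteps (c a : ℤ) : Finset ℤ := {b ∈ Ico c a | Even (b - c)}

theorem mem_evenSteps {c a b : ℤ} : b ∈ evenSteps c a ↔ c ≤ b ∧ b < a ∧ Even (b - c) := by
  simp [evenSteps, and_assoc]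

theorem evenSteps_eq_insert {c a : ℤ} (h : c < a) :
    evenSteps c a = insert c (evenSteps (c + 2) a) := by
  ext b
  simp only [mem_insert, mem_evenSteps, Int.even_iff]
  omega

theorem notMem_evenSteps_add_two {c a : ℤ} : c ∉ evenSteps (c + 2) a := by
  simp [mem_evenSteps]

theorem evenSteps_of_le {c a : ℤ} (h : a ≤ c) : evenSteps c a = ∅ := by
  simp [evenSteps, Ico_eq_empty_of_le h]

theorem sum_evenSteps_telescope (f : ℤ → ℚ) (n : ℕ) (c : ℤ) :
    ∑ b ∈ evenSteps c (c + 2 * n - 1), (f (b + 1) - f (b - 1)) =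
      f (c + 2 * n - 1) - f (c - 1) := by
  induction n generalizing c with
  | zero => simp [evenSteps_of_le]
  | succ n ih =>
    rw [evenSteps_eq_insert (by push_cast; omega), sum_insert notMem_evenSteps_add_two,
      show c + 2 * ((n + 1 : ℕ) : ℤ) - 1 = (c + 2) + 2 * n - 1 by push_cast; ring, ih]
    rw [show c + 2 - 1 = c + 1 by ring]
    ring

namespace IsCellCount

variable {W : Finset (ℤ × ℤ) → ℚ} {v : ℤ → ℤ → ℚ}

/-- The remaining cells of the row begin and end with an up-pointing one, and up-pointing cells can
only be matched within the row because the row below is gone. One of them is left over. -/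
theorem up_no_dent (hW : IsCellCount W v) {N m y : ℤ} (hy : y < m) {A : Finset ℤ} (n : ℕ) :
    ∀ c : ℤ, 0 ≤ c → 2 * N - y = c + 2 * n + 1 → (∀ d ∈ A, d < c) → ∀ U : Finset ℤ,
      W (rowState N m y c A U) = 0 := by
  induction n with
  | zero =>
    intro c hc hn hA U
    rw [hW.up _ c y (mem_rowState_row.2 ⟨hc, hy, by omega, le_rfl, fun h => by
      have := hA c h; omega⟩) (by rw [Int.odd_iff]; omega)
      (by rw [mem_rowState_row]; omega) (by rw [mem_rowState]; simp)]
    rw [if_neg]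
    rw [mem_rowState_row]; push_cast at hn; omega
  | succ n ih =>
    intro c hc hn hA U
    push_cast at hn
    have hA' : ∀ d, c ≤ d → d ∉ A := fun d hd h => by have := hA d h; omega
    rw [hW.up _ c y (mem_rowState_row.2 ⟨hc, hy, by omega, le_rfl, hA' c le_rfl⟩)
      (by rw [Int.odd_iff]; omega) (by rw [mem_rowState_row]; omega)
      (by rw [mem_rowState]; simp), if_pos, rowState_sdiff_horizontal]
    · exact ih (c + 2) (by omega) (by omega) (fun d hd => by have := hA d hd; omega) U
    · exact mem_rowState_row.2 ⟨by omega, hy, by omega, by omega, hA' _ (by omega)⟩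

/-- A vertical lozenge would leave a segment as in `up_no_dent`, so the rest of the row is tiled by
horizontal pairs. -/
theorem down_no_dent (hW : IsCellCount W v) {N m y : ℤ} (hy : y < m) {A : Finset ℤ} (n : ℕ) :
    ∀ c : ℤ, 0 ≤ c → 2 * N - y = c + 2 * n → (∀ d ∈ A, d < c) → ∀ U : Finset ℤ,
      W (rowState N m y c A U) = W (dentedRegion N m (y + 1) U) := by
  induction n with
  | zero =>
    intro c hc hn hA U
    rw [rowState_eq_dentedRegion (by simp at hn; omega)]
  | succ n ih =>
    intro c hc hn hA U
    push_cast at hn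
    have hA' : ∀ d, c ≤ d → d ∉ A := fun d hd h => by have := hA d h; omega
    rw [hW.down _ c y (mem_rowState_row.2 ⟨hc, hy, by omega, le_rfl, hA' c le_rfl⟩)
      (by rw [Int.even_iff]; omega) (by rw [mem_rowState_row]; omega),
      if_pos (mem_rowState_row.2 ⟨by omega, hy, by omega, by omega, hA' _ (by omega)⟩),
      rowState_sdiff_horizontal, rowState_sdiff_vertical,
      ih (c + 2) (by omega) (by omega) (fun d hd => by have := hA d hd; omega) U,
      hW.up_no_dent hy n (c + 1) (by omega) (by omega) (fun d hd => by have := hA d hd; omega)]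
    simp

/-- From an up-pointing cell to the next dent the number of cells is even, and the horizontal
pairing is forced. -/
theorem up_dent (hW : IsCellCount W v) {N m y : ℤ} (hy : y < m) {A : Finset ℤ} {a : ℤ}
    (ha : a ∈ A) (haN : a < 2 * N - y) (hay : Odd (a - y)) (n : ℕ) :
    ∀ c : ℤ, 0 ≤ c → a = c + 2 * n → (∀ d ∈ A, c ≤ d → a ≤ d) → ∀ U : Finset ℤ,
      W (rowState N m y c A U) = W (rowState N m y (a + 1) A U) := by
  rw [Int.odd_iff] at hay
  induction n with
  | zero =>
    intro c hc hn hA U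
    simp only [CharP.cast_eq_zero, mul_zero, add_zero] at hn
    subst hn
    rw [rowState_congr]
    intro d _
    constructor
    · rintro ⟨h1, h2⟩
      refine ⟨?_, h2⟩
      have : d ≠ a := fun h => h2 (h ▸ ha)
      omega
    · rintro ⟨h1, h2⟩
      exact ⟨by omega, h2⟩
  | succ n ih =>
    intro c hc hn hA U
    push_cast at hn
    have hA' : ∀ d, c ≤ d → d < a → d ∉ A := fun d hd hda h => by
      have := hA d h hd; omega
    rw [hW.up _ c y (mem_rowState_row.2 ⟨hc, hy, by omega, le_rfl, hA' c le_rfl (by omega)⟩)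
      (by rw [Int.odd_iff]; omega) (by rw [mem_rowState_row]; omega)
      (by rw [mem_rowState]; simp), if_pos, rowState_sdiff_horizontal]
    · exact ih (c + 2) (by omega) (by omega) (fun d hd hcd => hA d hd (by omega)) U
    · exact mem_rowState_row.2 ⟨by omega, hy, by omega, by omega, hA' _ (by omega) (by omega)⟩

/-- Between a down-pointing cell and the next dent there is one down-pointing cell too many. Exactly
one vertical lozenge occurs, at some `b`; after it the pairing is forced by `up_dent`. -/
theorem down_dent (hW : IsCellCount W v) {N m y : ℤ} (hy : y + 1 < m) {A : Finset ℤ} {a : ℤ}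
    (ha : a ∈ A) (haN : a < 2 * N - y) (hay : Odd (a - y)) (n : ℕ) :
    ∀ c : ℤ, 0 ≤ c → a = c + 2 * n + 1 → (∀ d ∈ A, c ≤ d → a ≤ d) → ∀ U : Finset ℤ,
      (∀ d ∈ U, d < c) → W (rowState N m y c A U) =
        ∑ b ∈ evenSteps c a, v b y * W (rowState N m y (a + 1) A (insert b U)) := by
  have hay' := hay
  rw [Int.odd_iff] at hay'
  induction n with
  | zero =>
    intro c hc hn hA U hU
    simp only [CharP.cast_eq_zero, mul_zero, add_zero] at hn
    have hU' : c ∉ U := fun h => lt_irrefl _ (hU c h)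
    rw [evenSteps_eq_insert (by omega), evenSteps_of_le (by omega)]
    rw [hW.down _ c y (mem_rowState_row.2 ⟨hc, by omega, by omega, le_rfl, fun h => by
      have := hA c h le_rfl; omega⟩) (by rw [Int.even_iff]; omega)
      (by rw [mem_rowState_row]; omega), if_neg, if_pos, rowState_sdiff_vertical,
      hW.up_dent (by omega) ha haN hay 0 (c + 1) (by omega) (by simpa using hn)
      (fun d hd hcd => hA d hd (by omega))]
    · simp
    · exact mem_rowState_row_succ.2 ⟨hc, hy, by omega, hU'⟩
    · rw [mem_rowState_row, ← hn]
      simp [ha]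
  | succ n ih =>
    intro c hc hn hA U hU
    push_cast at hn
    have hU' : c ∉ U := fun h => lt_irrefl _ (hU c h)
    have hA' : ∀ d, c ≤ d → d < a → d ∉ A := fun d hd hda h => by
      have := hA d h hd; omega
    rw [evenSteps_eq_insert (by omega), sum_insert notMem_evenSteps_add_two,
      hW.down _ c y (mem_rowState_row.2 ⟨hc, by omega, by omega, le_rfl,
        hA' c le_rfl (by omega)⟩) (by rw [Int.even_iff]; omega)
      (by rw [mem_rowState_row]; omega), if_pos, if_pos, rowState_sdiff_vertical,
      rowState_sdiff_horizontal,
      hW.up_dent (by omega) ha haN hay (n + 1) (c + 1) (by omega) (by push_cast; omega)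
      (fun d hd hcd => hA d hd (by omega)), add_comm,
      ih (c + 2) (by omega) (by omega) (fun d hd hcd => hA d hd (by omega)) U
        (fun d hd => by have := hU d hd; omega)]
    · exact mem_rowState_row_succ.2 ⟨hc, hy, by omega, hU'⟩
    · exact mem_rowState_row.2 ⟨by omega, by omega, by omega, by omega,
        hA' _ (by omega) (by omega)⟩

end IsCellCount

/-- The possible positions of the vertical lozenge between the dents `a (i - 1)` and `a i`,
where `c` is the first admissible position left of `a 0`. -/
noncomputable def gap {k : ℕ} (c : ℤ) (a : Fin k → ℤ) (i : Fin k) : Finset ℤ :=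
  evenSteps ((Fin.cons c fun j => a j + 1 : Fin (k + 1) → ℤ) i.castSucc) (a i)

theorem gap_zero {k : ℕ} (c : ℤ) (a : Fin (k + 1) → ℤ) : gap c a 0 = evenSteps c (a 0) := rfl

theorem gap_succ_eq {k : ℕ} (c : ℤ) (a : Fin (k + 1) → ℤ) (i : Fin k) :
    gap c a i.succ = evenSteps (a i.castSucc + 1) (a i.succ) := by
  unfold gap
  rw [← Fin.succ_castSucc, Fin.cons_succ]

theorem gap_succ {k : ℕ} (c : ℤ) (a : Fin (k + 1) → ℤ) (i : Fin k) :
    gap c a i.succ = gap (a 0 + 1) (fun j => a j.succ) i := by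
  rw [gap_succ_eq]
  cases k with
  | zero => exact i.elim0
  | succ k =>
    refine Fin.cases ?_ (fun j => ?_) i
    · rfl
    · rw [gap_succ_eq, Fin.succ_castSucc]

theorem sum_piFinset_gap {k : ℕ} (c : ℤ) (a : Fin (k + 1) → ℤ) (f : (Fin (k + 1) → ℤ) → ℚ) :
    ∑ b ∈ Fintype.piFinset (gap c a), f b =
      ∑ b₀ ∈ evenSteps c (a 0), ∑ b ∈ Fintype.piFinset (gap (a 0 + 1) fun j => a j.succ),
        f (Fin.cons b₀ b) := by
  rw [← sum_product']
  refine sum_bij' (fun b _ => (b 0, fun j => b j.succ)) (fun p _ => Fin.cons p.1 p.2)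
    ?_ ?_ ?_ ?_ ?_
  · intro b hb
    rw [Fintype.mem_piFinset] at hb
    rw [mem_product, Fintype.mem_piFinset]
    exact ⟨hb 0, fun i => gap_succ c a i ▸ hb i.succ⟩
  · rintro ⟨b₀, b⟩ hb
    rw [mem_product, Fintype.mem_piFinset] at hb
    rw [Fintype.mem_piFinset]
    refine Fin.cases ?_ fun i => ?_
    · exact hb.1
    · rw [gap_succ]
      exact hb.2 i
  · intro b _
    exact Fin.cons_self_tail b
  · intro p _
    rfl
  · intro b _
    exact congrArg f (Fin.cons_self_tail b).symm

/-- The transfer from a row whose first free cell `c` points down to the next row. -/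
theorem IsCellCount.row_transfer {W : Finset (ℤ × ℤ) → ℚ} {v : ℤ → ℤ → ℚ}
    (hW : IsCellCount W v) {N m y : ℤ} (hy : y < m) {A : Finset ℤ} (k : ℕ) :
    ∀ (c : ℤ) (a : Fin k → ℤ) (U : Finset ℤ), (0 < k → y + 1 < m) → 0 ≤ c → c ≤ 2 * N - y →
      Even (c - y) → StrictMono a →
      (∀ i, c ≤ a i) → (∀ i, a i < 2 * N - y) → (∀ i, Odd (a i - y)) →
      (∀ d, c ≤ d → (d ∈ A ↔ ∃ i, d = a i)) → (∀ d ∈ U, d < c) →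
      W (rowState N m y c A U) = ∑ b ∈ Fintype.piFinset (gap c a),
        (∏ i, v (b i) y) * W (dentedRegion N m (y + 1) (U ∪ univ.image b)) := by
  induction k with
  | zero =>
    intro c a U _ hc hcN hcy _ _ _ _ hA _
    rw [Int.even_iff] at hcy
    rw [hW.down_no_dent hy (2 * N - y - c).toNat.div2 c hc ?_ fun d hd => ?_]
    · simp
    · rw [Nat.div2_val]; omega
    · by_contra h
      obtain ⟨i, -⟩ := (hA d (by omega)).1 hd
      exact i.elim0
  | succ k ih =>
    intro c a U hym hc hcN hcy hmono hca haN hay hA hU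
    have hcy' := hcy
    have hay0 := hay 0
    have hca0 := hca 0
    have haN0 := haN 0
    rw [Int.even_iff] at hcy'
    rw [Int.odd_iff] at hay0
    have h0A : a 0 ∈ A := (hA _ hca0).2 ⟨0, rfl⟩
    have hlt : ∀ i : Fin k, a 0 < a i.succ := fun i => hmono (Fin.succ_pos i)
    rw [hW.down_dent (hym (by omega)) h0A haN0 (hay 0) ((a 0 - c).toNat / 2) c hc (by omega)
      (fun d hd hcd => ?_) U hU, sum_piFinset_gap]
    · refine sum_congr rfl fun b hb => ?_
      rw [mem_evenSteps] at hb
      rw [ih (a 0 + 1) (fun j => a j.succ) (insert b U) (fun _ => hym (by omega)) (by omega)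
        (by omega) (by rw [Int.even_iff]; omega)
        (fun i j hij => hmono (Fin.succ_lt_succ_iff.2 hij)) (fun i => by have := hlt i; omega)
        (fun i => haN _) (fun i => hay _) ?_ ?_, mul_sum]
      · refine sum_congr rfl fun b' _ => ?_
        rw [Fin.prod_univ_succ, mul_assoc]
        congr 4
        rw [insert_eq, union_comm {b}, union_assoc]
        congr 1
        ext d
        simp [Fin.exists_fin_succ, eq_comm]
      · intro d hd
        rw [hA d (by omega), Fin.exists_fin_succ]
        simp only [or_iff_right_iff_imp]
        rintro rfl
        omega
      · intro d hd
        rcases mem_insert.1 hd with rfl | hd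
        · omega
        · have := hU d hd; omega
    · obtain ⟨i, rfl⟩ := (hA d hcd).1 hd
      exact hmono.monotone (Fin.zero_le i)

/-! ### Closed forms -/

/-- The central factorial polynomials of even degree, for steps of size two. -/
def evenPoly (j : ℕ) (x : ℚ) : ℚ := ∏ i ∈ range j, (x ^ 2 - (2 * i) ^ 2)

/-- The central factorial polynomials of odd degree, for steps of size two. -/
def oddPoly (j : ℕ) (x : ℚ) : ℚ := x * ∏ i ∈ range j, (x ^ 2 - (2 * i + 1) ^ 2)

theorem oddPoly_neg (j : ℕ) (x : ℚ) : oddPoly j (-x) = -oddPoly j x := by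
  simp [oddPoly]

/-- The shift is written with a factor even in `x`, so that `x - 1`, reached through `-x`, has the
same factor and the central difference reduces to a difference of two quadratics. -/
theorem evenPoly_succ_add_one (j : ℕ) (x : ℚ) :
    evenPoly (j + 1) (x + 1) =
      (x + 1) * (x + (2 * j + 1)) * ∏ i ∈ range j, (x ^ 2 - (2 * i + 1) ^ 2) := by
  induction j with
  | zero => simp [evenPoly]; ring
  | succ j ih =>
    rw [evenPoly, prod_range_succ, ← evenPoly, ih, prod_range_succ]
    push_cast
    ring

theorem evenPoly_neg (j : ℕ) (x : ℚ) : evenPoly j (-x) = evenPoly j x := by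
  simp [evenPoly]

theorem evenPoly_succ_sub (j : ℕ) (x : ℚ) :
    evenPoly (j + 1) (x + 1) - evenPoly (j + 1) (x - 1) = 4 * (j + 1) * oddPoly j x := by
  rw [← evenPoly_neg (j + 1) (x - 1), show -(x - 1) = -x + 1 by ring, evenPoly_succ_add_one,
    evenPoly_succ_add_one, oddPoly, neg_sq]
  ring

theorem oddPoly_succ_add_one (j : ℕ) (x : ℚ) :
    oddPoly (j + 1) (x + 1) =
      (x + 1) * x * (x + (2 * j + 2)) * ∏ i ∈ range j, (x ^ 2 - (2 * (i + 1)) ^ 2) := by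
  induction j with
  | zero => simp [oddPoly]; ring
  | succ j ih =>
    rw [oddPoly, prod_range_succ, ← mul_assoc, ← oddPoly, ih, prod_range_succ]
    push_cast
    ring

theorem oddPoly_sub (j : ℕ) (x : ℚ) :
    oddPoly j (x + 1) - oddPoly j (x - 1) = 2 * (2 * j + 1) * evenPoly j x := by
  cases j with
  | zero => simp [oddPoly, evenPoly]; ring
  | succ j =>
    rw [show x - 1 = -(-x + 1) by ring, oddPoly_neg, oddPoly_succ_add_one,
      oddPoly_succ_add_one, evenPoly, prod_range_succ', neg_sq]
    push_cast
    ring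

/-- The `j`-th entry is a monic polynomial of degree `j` in `x i ^ 2`, so the determinant is that of
Vandermonde in the squares. -/
theorem det_evenPoly {k : ℕ} (x : Fin k → ℚ) :
    (Matrix.of fun i j : Fin k => evenPoly j (x i)).det =
      ∏ i, ∏ j ∈ Ioi i, (x j ^ 2 - x i ^ 2) := by
  rw [← Matrix.det_vandermonde, Matrix.det_eval_matrixOfPolynomials_eq_det_vandermonde
    (fun i => x i ^ 2) (fun j => ∏ i ∈ range j,
      (Polynomial.X - Polynomial.C ((2 * (i : ℚ)) ^ 2)))]
  · simp [evenPoly, Polynomial.eval_prod]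
  · intro i
    rw [Polynomial.natDegree_prod_of_monic _ _ fun j _ => Polynomial.monic_X_sub_C _]
    simp only [Polynomial.natDegree_X_sub_C]
    simp
  · exact fun i => Polynomial.monic_prod_of_monic _ _ fun j _ => Polynomial.monic_X_sub_C _

theorem det_oddPoly {k : ℕ} (x : Fin k → ℚ) :
    (Matrix.of fun i j : Fin k => oddPoly j (x i)).det =
      (∏ i, x i) * ∏ i, ∏ j ∈ Ioi i, (x j ^ 2 - x i ^ 2) := by
  rw [← Matrix.det_vandermonde, Matrix.det_eval_matrixOfPolynomials_eq_det_vandermonde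
    (fun i => x i ^ 2) (fun j => ∏ i ∈ range j,
      (Polynomial.X - Polynomial.C ((2 * (i : ℚ) + 1) ^ 2))), ← Matrix.det_mul_column]
  · simp [oddPoly, Polynomial.eval_prod]
  · intro i
    rw [Polynomial.natDegree_prod_of_monic _ _ fun j _ => Polynomial.monic_X_sub_C _]
    simp only [Polynomial.natDegree_X_sub_C]
    simp
  · exact fun i => Polynomial.monic_prod_of_monic _ _ fun j _ => Polynomial.monic_X_sub_C _

/-- Multilinearity in the rows. It applies because the interlacing conditions make the positions
range independently over a box. -/
theorem sum_piFinset_det {k : ℕ} (A : Fin k → Finset ℤ) (g : ℤ → Fin k → ℚ) :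
    ∑ b ∈ Fintype.piFinset A, (Matrix.of fun i j => g (b i) j).det =
      (Matrix.of fun i j => ∑ x ∈ A i, g x j).det := by
  have h := (Matrix.detRowAlternating (R := ℚ) (n := Fin k)).toMultilinearMap.map_sum_finset
    (fun _ x => g x) A
  have h' : (Matrix.of fun i j => ∑ x ∈ A i, g x j) = fun i => ∑ x ∈ A i, g x := by
    ext i j
    simp
  rw [h']
  exact h.symm

theorem det_sub_pred {k : ℕ} (B : Matrix (Fin (k + 1)) (Fin (k + 1)) ℚ) :
    (Matrix.of (Fin.cons (B 0) fun i => B i.succ - B i.castSucc)).det = B.det := by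
  refine (Matrix.det_eq_of_forall_row_eq_smul_add_pred (fun _ => 1) ?_ ?_).symm
  · intro j
    simp
  · intro i j
    simp

/-- The constant in the closed form for an odd number of rows. -/
def evenConst (k : ℕ) : ℚ := ∏ i ∈ range k, (4 ^ i * ((2 * i).factorial : ℚ))⁻¹

/-- The constant in the closed form for an even number of rows. -/
def oddConst (k : ℕ) : ℚ := ∏ i ∈ range k, (2 * 4 ^ i * ((2 * i + 1).factorial : ℚ))⁻¹

theorem evenConst_succ (k : ℕ) :
    evenConst (k + 1) = oddConst k * ∏ j : Fin k, (4 * ((j : ℚ) + 1))⁻¹ := by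
  rw [Fin.prod_univ_eq_prod_range (fun j => (4 * ((j : ℚ) + 1))⁻¹), evenConst, oddConst,
    prod_range_succ', ← prod_mul_distrib]
  simp only [mul_zero, Nat.factorial_zero, pow_zero, Nat.cast_one, mul_one, inv_one]
  refine prod_congr rfl fun j _ => ?_
  rw [← mul_inv, mul_add, mul_one, Nat.factorial_succ]
  push_cast
  ring_nf

theorem oddConst_eq (k : ℕ) :
    oddConst k = evenConst k * ∏ j : Fin k, (2 * (2 * (j : ℚ) + 1))⁻¹ := by
  rw [Fin.prod_univ_eq_prod_range (fun j => (2 * (2 * (j : ℚ) + 1))⁻¹), evenConst, oddConst,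
    ← prod_mul_distrib]
  refine prod_congr rfl fun j _ => ?_
  rw [← mul_inv, Nat.factorial_succ]
  push_cast
  ring_nf

/-- The first column consists of ones; subtracting from each row its predecessor clears it below the
top entry. This accounts for odd rows having one vertical lozenge fewer than dents. -/
theorem det_evenPoly_succ {k : ℕ} (x : Fin (k + 1) → ℚ) :
    (Matrix.of fun i j : Fin (k + 1) => evenPoly j (x i)).det =
      (Matrix.of fun i j : Fin k =>
        evenPoly (j + 1) (x i.succ) - evenPoly (j + 1) (x i.castSucc)).det := by
  rw [← det_sub_pred, Matrix.det_succ_column_zero, Fin.sum_univ_succ, sum_eq_zero, add_zero]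
  · simp only [Fin.val_zero, pow_zero, one_mul, Matrix.of_apply, Fin.cons_zero]
    rw [show evenPoly 0 (x 0) = 1 by simp [evenPoly], one_mul]
    congr 1
  · intro i _
    simp [evenPoly]

theorem sum_evenSteps_sub {a c : ℤ} (hca : c ≤ a + 1) (h : Odd (a - c)) (f : ℤ → ℚ) :
    ∑ b ∈ evenSteps c a, (f (b + 1) - f (b - 1)) = f a - f (c - 1) := by
  rw [Int.odd_iff] at h
  have := sum_evenSteps_telescope f ((a + 1 - c).toNat / 2) c
  rwa [show c + 2 * (((a + 1 - c).toNat / 2 : ℕ) : ℤ) - 1 = a by omega] at this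

theorem sum_evenSteps_evenPoly {a c : ℤ} (hca : c ≤ a + 1) (h : Odd (a - c)) (j : ℕ) (σ : ℚ) :
    ∑ b ∈ evenSteps c a, evenPoly j (b + σ) =
      (2 * (2 * (j : ℚ) + 1))⁻¹ * (oddPoly j (a + σ) - oddPoly j ((c - 1 : ℤ) + σ)) := by
  rw [← sum_evenSteps_sub hca h fun b => oddPoly j (b + σ), mul_sum]
  refine sum_congr rfl fun b _ => ?_
  have h1 : (2 * (2 * (j : ℚ) + 1)) ≠ 0 := by positivity
  rw [eq_inv_mul_iff_mul_eq₀ h1, ← oddPoly_sub]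
  push_cast
  ring_nf

theorem sum_evenSteps_oddPoly {a c : ℤ} (hca : c ≤ a + 1) (h : Odd (a - c)) (j : ℕ) (σ : ℚ) :
    ∑ b ∈ evenSteps c a, oddPoly j (b + σ) =
      (4 * ((j : ℚ) + 1))⁻¹ * (evenPoly (j + 1) (a + σ) - evenPoly (j + 1) ((c - 1 : ℤ) + σ)) := by
  rw [← sum_evenSteps_sub hca h fun b => evenPoly (j + 1) (b + σ), mul_sum]
  refine sum_congr rfl fun b _ => ?_
  have h1 : (4 * ((j : ℚ) + 1)) ≠ 0 := by positivity
  rw [eq_inv_mul_iff_mul_eq₀ h1, ← evenPoly_succ_sub]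
  push_cast
  ring_nf

/-- The weights `v` of the vertical lozenges on the western side in the rows `y₀ ≤ y < m - 1` are
those for which the closed forms are symmetric about `-σ`. -/
structure IsBoundaryWeight (v : ℤ → ℤ → ℚ) (σ : ℚ) (y₀ m : ℤ) : Prop where
  inner : ∀ c y, 0 < c → v c y = 1
  sum_zero : ∀ (y : ℤ) (j : ℕ) (a : ℤ), y₀ ≤ y → y + 1 < m → Even y → 0 < a → Odd a →
    ∑ b ∈ evenSteps 0 a, v b y * evenPoly j (b + σ) =
      (2 * (2 * (j : ℚ) + 1))⁻¹ * oddPoly j (a + σ)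

theorem isBoundaryWeight_one {v : ℤ → ℤ → ℚ} {y₀ m : ℤ} (hv : ∀ c y, v c y = 1) :
    IsBoundaryWeight v 1 y₀ m where
  inner c y _ := hv c y
  sum_zero y j a _ _ _ ha hodd := by
    simp only [hv, one_mul]
    rw [sum_evenSteps_evenPoly (by omega) (by simpa using hodd)]
    -- The lower end of the telescoping sum is `oddPoly j (-1 + 1) = 0`.
    simp [oddPoly]

theorem isBoundaryWeight_half {v : ℤ → ℤ → ℚ} {y₀ m : ℤ} (hv : ∀ c y, 0 < c → v c y = 1)
    (hv₀ : ∀ y, y₀ ≤ y → y + 1 < m → Even y → v 0 y = 1 / 2) :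
    IsBoundaryWeight v 0 y₀ m where
  inner := hv
  sum_zero y j a hy hym hye ha hodd := by
    rw [Int.odd_iff] at hodd
    rw [evenSteps_eq_insert ha, sum_insert notMem_evenSteps_add_two, hv₀ y hy hym hye,
      sum_congr rfl fun b hb => by
        rw [hv b y (by rw [mem_evenSteps] at hb; omega), one_mul],
      sum_evenSteps_evenPoly (by omega) (by rw [Int.odd_iff]; omega)]
    -- At `0` this reads `2 * oddPoly j 1 = 2 * (2 * j + 1) * evenPoly j 0` by oddness, so the
    -- halved term at `0` cancels the lower end `oddPoly j 1` of the sum from `2` on.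
    have h := oddPoly_sub j 0
    rw [show (0 : ℚ) - 1 = -1 by ring, oddPoly_neg] at h
    have h1 : (2 * (2 * (j : ℚ) + 1)) ≠ 0 := by positivity
    rw [eq_inv_mul_iff_mul_eq₀ h1, mul_add, mul_inv_cancel_left₀ h1]
    push_cast
    norm_num at h ⊢
    linarith

/-! ### The induction over the rows. -/

variable {W : Finset (ℤ × ℤ) → ℚ} {v : ℤ → ℤ → ℚ}

theorem strictMono_of_mem_gap {k : ℕ} {c : ℤ} {a b : Fin k → ℤ}
    (hb : b ∈ Fintype.piFinset (gap c a)) : StrictMono b := by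
  cases k with
  | zero => exact fun i => i.elim0
  | succ k =>
    refine Fin.strictMono_iff_lt_succ.2 fun i => ?_
    rw [Fintype.mem_piFinset] at hb
    have h1 := hb i.castSucc
    have h2 := hb i.succ
    rw [gap_succ_eq, mem_evenSteps] at h2
    have h3 : b i.castSucc < a i.castSucc := (mem_evenSteps.1 h1).2.1
    omega

theorem mem_gap_bounds {k : ℕ} {c : ℤ} {a : Fin k → ℤ} (hca : ∀ i, c ≤ a i)
    (hac : ∀ i, Odd (a i - c)) {i : Fin k} {x : ℤ} (hx : x ∈ gap c a i) :
    c ≤ x ∧ x < a i ∧ Even (x - c) := by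
  cases k with
  | zero => exact i.elim0
  | succ k =>
    revert hx
    refine Fin.cases ?_ (fun i => ?_) i <;> intro hx
    · rw [gap_zero, mem_evenSteps] at hx
      exact hx
    · rw [gap_succ_eq, mem_evenSteps] at hx
      have h1 := hca i.castSucc
      have h2 := hac i.castSucc
      rw [Int.odd_iff] at h2
      rw [Int.even_iff] at hx ⊢
      omega

/-- The closed form for an even number of remaining rows implies the one for one more row. -/
theorem closed_form_even_of_odd (hW : IsCellCount W v) {σ : ℚ} {y₀ m N : ℤ}
    (hv : IsBoundaryWeight v σ y₀ m) {k : ℕ} {y : ℤ} (hy : Odd y) (hym : y < m)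
    (hkm : 0 < k → y + 1 < m)
    (ih : ∀ b : Fin k → ℤ, StrictMono b → (∀ i, 0 ≤ b i) → (∀ i, b i < 2 * N - (y + 1)) →
      (∀ i, Odd (b i)) → W (dentedRegion N m (y + 1) (univ.image b)) =
        oddConst k * (Matrix.of fun i j : Fin k => oddPoly j (b i + σ)).det)
    (a : Fin (k + 1) → ℤ) (hmono : StrictMono a) (ha0 : ∀ i, 0 ≤ a i)
    (haN : ∀ i, a i < 2 * N - y) (hae : ∀ i, Even (a i)) :
    W (dentedRegion N m y (univ.image a)) =
      evenConst (k + 1) * (Matrix.of fun i j : Fin (k + 1) => evenPoly j (a i + σ)).det := by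
  have hy' := hy
  rw [Int.odd_iff] at hy'
  have hae' : ∀ i, a i % 2 = 0 := fun i => Int.even_iff.1 (hae i)
  have ha00 := ha0 0
  have hae0 := hae' 0
  have haN0 := haN 0
  have hlt : ∀ i : Fin k, a 0 < a i.succ := fun i => hmono (Fin.succ_pos i)
  have hodd : ∀ i : Fin k, Odd (a i.succ - (a 0 + 1)) := fun i => by
    have := hae' i.succ
    rw [Int.odd_iff]; omega
  rw [dentedRegion, hW.up_dent hym (mem_image_of_mem a (mem_univ 0)) (haN 0)
    (by rw [Int.odd_iff]; omega) ((a 0).toNat / 2) 0 le_rfl (by omega) ?_,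
    hW.row_transfer hym k (a 0 + 1) (fun j => a j.succ) ∅ hkm (by omega) (by omega)
    (by rw [Int.even_iff]; omega) (fun i j hij => hmono (Fin.succ_lt_succ_iff.2 hij))
    (fun i => by have := hlt i; omega) (fun i => haN _)
    (fun i => by have := hae' i.succ; rw [Int.odd_iff]; omega) ?_ (by simp)]
  · have key : ∀ b ∈ Fintype.piFinset (gap (a 0 + 1) fun j => a j.succ),
        (∏ i, v (b i) y) * W (dentedRegion N m (y + 1) (∅ ∪ univ.image b)) =
          oddConst k * (Matrix.of fun i j : Fin k => oddPoly j (b i + σ)).det := by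
      intro b hb
      have hbd := fun i => mem_gap_bounds (fun i => by have := hlt i; omega) hodd
        (Fintype.mem_piFinset.1 hb i)
      -- In an odd row every vertical lozenge lies to the right of the first dent, hence not on the
      -- western side.
      rw [prod_eq_one fun i _ => hv.inner _ _ (by have := hbd i; omega), one_mul, empty_union]
      refine ih b (strictMono_of_mem_gap hb) (fun i => ?_) (fun i => ?_) (fun i => ?_)
      · have := hbd i; omega
      · have := hbd i
        have := haN i.succ
        omega
      · have := (hbd i).2.2
        rw [Int.even_iff] at this
        rw [Int.odd_iff]; omega
    rw [sum_congr rfl key, ← mul_sum, sum_piFinset_det _ fun x j => oddPoly j (x + σ),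
      evenConst_succ, mul_assoc, det_evenPoly_succ, ← Matrix.det_mul_row]
    congr 2
    ext i j
    simp only [Matrix.of_apply]
    -- The value `0` is arbitrary: only the first gap depends on it.
    rw [← gap_succ (0 : ℤ), gap_succ_eq, sum_evenSteps_oddPoly]
    · simp
    · have := hmono (Fin.castSucc_lt_succ (i := i)); omega
    · have := hae' i.succ
      have := hae' i.castSucc
      rw [Int.odd_iff]; omega
  · intro d hd
    rw [mem_image]
    simp only [mem_univ, true_and, Fin.exists_fin_succ]
    constructor
    · rintro (h | ⟨i, h⟩)
      · omega
      · exact ⟨i, h.symm⟩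
    · rintro ⟨i, h⟩
      exact Or.inr ⟨i, h.symm⟩
  · intro d hd _
    obtain ⟨i, -, rfl⟩ := mem_image.1 hd
    exact hmono.monotone (Fin.zero_le i)

/-- The closed form for an odd number of remaining rows implies the one for one more row. -/
theorem closed_form_odd_of_even (hW : IsCellCount W v) {σ : ℚ} {y₀ m N : ℤ}
    (hv : IsBoundaryWeight v σ y₀ m) {k : ℕ} {y : ℤ} (hy : Even y) (hy0 : y₀ ≤ y)
    (hym : y + 1 < m)
    (ih : ∀ b : Fin (k + 1) → ℤ, StrictMono b → (∀ i, 0 ≤ b i) →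
      (∀ i, b i < 2 * N - (y + 1)) →
      (∀ i, Even (b i)) → W (dentedRegion N m (y + 1) (univ.image b)) =
        evenConst (k + 1) * (Matrix.of fun i j : Fin (k + 1) => evenPoly j (b i + σ)).det)
    (a : Fin (k + 1) → ℤ) (hmono : StrictMono a) (ha0 : ∀ i, 0 ≤ a i)
    (haN : ∀ i, a i < 2 * N - y) (hao : ∀ i, Odd (a i)) :
    W (dentedRegion N m y (univ.image a)) =
      oddConst (k + 1) * (Matrix.of fun i j : Fin (k + 1) => oddPoly j (a i + σ)).det := by
  have hy' := hy
  rw [Int.even_iff] at hy'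
  have hao' : ∀ i, a i % 2 = 1 := fun i => Int.odd_iff.1 (hao i)
  have ha00 := ha0 0
  have hao0 := hao' 0
  have haN0 := haN 0
  rw [dentedRegion, hW.row_transfer (by omega) (k + 1) 0 a ∅ (fun _ => hym) le_rfl (by omega)
    (by rw [Int.even_iff]; omega) hmono ha0 haN
    (fun i => by have := hao' i; rw [Int.odd_iff]; omega) (fun d _ => by simp [eq_comm])
    (by simp)]
  have key : ∀ b ∈ Fintype.piFinset (gap 0 a),
      (∏ i, v (b i) y) * W (dentedRegion N m (y + 1) (∅ ∪ univ.image b)) =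
        evenConst (k + 1) *
          (Matrix.of fun i j : Fin (k + 1) => v (b i) y * evenPoly j (b i + σ)).det := by
    intro b hb
    have hbd := fun i => mem_gap_bounds ha0 (fun i => by simpa using hao i)
      (Fintype.mem_piFinset.1 hb i)
    rw [empty_union, ih b (strictMono_of_mem_gap hb) (fun i => (hbd i).1) (fun i => ?_)
      (fun i => by simpa using (hbd i).2.2), mul_left_comm]
    · congr 1
      exact (Matrix.det_mul_column _ _).symm
    · have := hbd i
      have := haN i
      omega
  rw [sum_congr rfl key, ← mul_sum, sum_piFinset_det _ fun x j => v x y * evenPoly j (x + σ),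
    oddConst_eq, mul_assoc]
  congr 1
  -- With rows replaced by consecutive differences, the later rows are the sums over gaps between
  -- dents, and the first row is the sum over the western gap, whose lower end contributes nothing
  -- by `sum_zero`.
  rw [← det_sub_pred (Matrix.of fun i j : Fin (k + 1) => oddPoly j (a i + σ)),
    ← Matrix.det_mul_row]
  congr 1
  ext i j
  refine Fin.cases ?_ (fun i => ?_) i
  · simp only [Matrix.of_apply, gap_zero, Fin.cons_zero]
    exact hv.sum_zero y j (a 0) hy0 hym hy (by omega) (hao 0)
  · simp only [Matrix.of_apply, gap_succ_eq, Fin.cons_succ, Pi.sub_apply]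
    have h1 := ha0 i.castSucc
    have h2 := hao' i.castSucc
    have h3 := hao' i.succ
    have h4 := hmono (Fin.castSucc_lt_succ (i := i))
    rw [sum_congr rfl fun b hb => by
        rw [hv.inner b y (by rw [mem_evenSteps] at hb; omega), one_mul],
      sum_evenSteps_evenPoly (by omega) (by rw [Int.odd_iff]; omega)]
    simp

theorem closed_form_odd (hW : IsCellCount W v) {σ : ℚ} {y₀ m N : ℤ} (hm : Even m)
    (hv : IsBoundaryWeight v σ y₀ m) (k : ℕ) (hk : y₀ ≤ m - 2 * k)
    (a : Fin k → ℤ) (hmono : StrictMono a) (ha0 : ∀ i, 0 ≤ a i)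
    (haN : ∀ i, a i < 2 * N - (m - 2 * k)) (hao : ∀ i, Odd (a i)) :
    W (dentedRegion N m (m - 2 * k) (univ.image a)) =
      oddConst k * (Matrix.of fun i j : Fin k => oddPoly j (a i + σ)).det := by
  have hm' := hm
  rw [Int.even_iff] at hm'
  induction k with
  | zero =>
    have hempty : dentedRegion N m (m - 2 * (0 : ℕ)) (univ.image a) = ∅ := by
      refine eq_empty_of_forall_notMem fun p hp => ?_
      rw [dentedRegion, mem_rowState] at hp
      simp only [CharP.cast_eq_zero, mul_zero, sub_zero] at hp
      omega
    rw [hempty, hW.empty]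
    simp [oddConst]
  | succ k ih =>
    push_cast at hk haN ⊢
    refine closed_form_odd_of_even hW hv (by rw [Int.even_iff]; omega) hk (by omega) ?_ a hmono
      ha0 haN hao
    intro b hbm hb0 hbN hbe
    refine closed_form_even_of_odd hW hv (by rw [Int.odd_iff]; omega) (by omega) (by omega) ?_ b
      hbm hb0 hbN hbe
    intro d hdm hd0 hdN hdo
    rw [show m - 2 * ((k : ℤ) + 1) + 1 + 1 = m - 2 * k by ring] at hdN ⊢
    exact ih (by omega) d hdm hd0 hdN hdo

theorem closed_form_even (hW : IsCellCount W v) {σ : ℚ} {y₀ m N : ℤ} (hm : Even m)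
    (hv : IsBoundaryWeight v σ y₀ m) (k : ℕ) (hk : y₀ ≤ m - 2 * k - 1)
    (a : Fin (k + 1) → ℤ) (hmono : StrictMono a) (ha0 : ∀ i, 0 ≤ a i)
    (haN : ∀ i, a i < 2 * N - (m - 2 * k - 1)) (hae : ∀ i, Even (a i)) :
    W (dentedRegion N m (m - 2 * k - 1) (univ.image a)) =
      evenConst (k + 1) * (Matrix.of fun i j : Fin (k + 1) => evenPoly j (a i + σ)).det := by
  have hm' := hm
  rw [Int.even_iff] at hm'
  -- For `k = 0` this is the top row: there is a single dent and no vertical lozenge, so no row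
  -- above is needed.
  refine closed_form_even_of_odd hW hv (by rw [Int.odd_iff]; omega) (by omega) (by omega) ?_ a
    hmono ha0 haN hae
  intro b hbm hb0 hbN hbo
  rw [sub_add_cancel] at hbN ⊢
  exact closed_form_odd hW hm hv k (by omega) b hbm hb0 hbN hbo

/-! ### Products over unions of intervals -/

theorem prod_oddPairs_succ (n : ℕ) (f : ℕ × ℕ → ℚ) :
    ∏ p ∈ oddPairs (n + 1), f p =
      (∏ p ∈ oddPairs n, f p) * ∏ i ∈ Icc 1 n with Odd (n + 1 - i), f (i, n + 1) := by
  have h : oddPairs (n + 1) = oddPairs n ∪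
      ({i ∈ Icc 1 n | Odd (n + 1 - i)} : Finset ℕ).image fun i => (i, n + 1) := by
    ext ⟨i, j⟩
    simp only [oddPairs, mem_filter, mem_product, mem_Icc, mem_union, mem_image, Prod.mk.injEq,
      Nat.odd_iff]
    constructor
    · rintro ⟨h1, h2, h3⟩
      by_cases hj : j = n + 1
      · exact Or.inr ⟨i, by omega⟩
      · exact Or.inl (by omega)
    · rintro (h | ⟨i', h⟩) <;> omega
  rw [h, prod_union, prod_image]
  · simp
  · rw [disjoint_left]
    rintro ⟨i, j⟩ h1 h2
    simp only [oddPairs, mem_filter, mem_product, mem_Icc, mem_image, Prod.mk.injEq] at h1 h2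
    omega

theorem prod_evenPairs_succ (n : ℕ) (f : ℕ × ℕ → ℚ) :
    ∏ p ∈ evenPairs (n + 1), f p =
      (∏ p ∈ evenPairs n, f p) * ∏ i ∈ Icc 1 n with Even (n + 1 - i), f (i, n + 1) := by
  have h : evenPairs (n + 1) = evenPairs n ∪
      ({i ∈ Icc 1 n | Even (n + 1 - i)} : Finset ℕ).image fun i => (i, n + 1) := by
    ext ⟨i, j⟩
    simp only [evenPairs, mem_filter, mem_product, mem_Icc, mem_union, mem_image, Prod.mk.injEq,
      Nat.even_iff]
    constructor
    · rintro ⟨h1, h2, h3⟩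
      by_cases hj : j = n + 1
      · exact Or.inr ⟨i, by omega⟩
      · exact Or.inl (by omega)
    · rintro (h | ⟨i', h⟩) <;> omega
  rw [h, prod_union, prod_image]
  · simp
  · rw [disjoint_left]
    rintro ⟨i, j⟩ h1 h2
    simp only [evenPairs, mem_filter, mem_product, mem_Icc, mem_image, Prod.mk.injEq] at h1 h2
    omega

theorem prod_even_indices {l : ℕ} {P : ℕ → Prop} [DecidablePred P] {n : ℕ}
    (hP : ∀ i, (i ∈ Icc 1 n ∧ P i) ↔ (i ∈ Icc 1 (2 * l) ∧ i % 2 = 0)) (f : ℕ → ℚ) :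
    ∏ i ∈ Icc 1 n with P i, f i = ∏ i ∈ Icc 1 l, f (2 * i) := by
  symm
  refine prod_bij (fun i _ => 2 * i) ?_ ?_ ?_ ?_
  · intro i hi
    rw [mem_filter, hP]
    simp only [mem_Icc] at hi ⊢
    omega
  · intro i _ j _ h
    omega
  · intro i hi
    rw [mem_filter, hP] at hi
    simp only [mem_Icc] at hi
    exact ⟨i / 2, by simp only [mem_Icc]; omega, by omega⟩
  · intro i _
    rfl

theorem prod_odd_indices {l : ℕ} {P : ℕ → Prop} [DecidablePred P] {n : ℕ}
    (hP : ∀ i, (i ∈ Icc 1 n ∧ P i) ↔ (i ∈ Icc 1 (2 * l) ∧ i % 2 = 1)) (f : ℕ → ℚ) :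
    ∏ i ∈ Icc 1 n with P i, f i = ∏ i ∈ Icc 1 l, f (2 * i - 1) := by
  symm
  refine prod_bij (fun i _ => 2 * i - 1) ?_ ?_ ?_ ?_
  · intro i hi
    rw [mem_filter, hP]
    simp only [mem_Icc] at hi ⊢
    omega
  · intro i hi j hj h
    simp only [mem_Icc] at hi hj
    omega
  · intro i hi
    rw [mem_filter, hP] at hi
    simp only [mem_Icc] at hi
    exact ⟨(i + 1) / 2, by simp only [mem_Icc]; omega, by omega⟩
  · intro i _
    rfl

/-- The new indices `2 * l + 1` and `2 * l + 2` are the ends of one new interval; their own pair is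
split off. -/
theorem prod_oddPairs_add_two (l : ℕ) (f : ℕ × ℕ → ℚ) :
    ∏ p ∈ oddPairs (2 * (l + 1)), f p = (∏ p ∈ oddPairs (2 * l), f p) *
      (∏ i ∈ Icc 1 l, f (2 * i, 2 * l + 1)) *
      ((∏ i ∈ Icc 1 l, f (2 * i - 1, 2 * l + 2)) * f (2 * l + 1, 2 * l + 2)) := by
  rw [show 2 * (l + 1) = 2 * l + 1 + 1 by ring, prod_oddPairs_succ, prod_oddPairs_succ,
    prod_even_indices (l := l) (fun i => by simp only [mem_Icc, Nat.odd_iff]; omega)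
      fun i => f (i, 2 * l + 1),
    prod_odd_indices (l := l + 1) (fun i => by simp only [mem_Icc, Nat.odd_iff]; omega)
      fun i => f (i, 2 * l + 1 + 1), prod_Icc_succ_top (by omega)]
  rfl

theorem prod_evenPairs_add_two (l : ℕ) (f : ℕ × ℕ → ℚ) :
    ∏ p ∈ evenPairs (2 * (l + 1)), f p = (∏ p ∈ evenPairs (2 * l), f p) *
      (∏ i ∈ Icc 1 l, f (2 * i - 1, 2 * l + 1)) * ∏ i ∈ Icc 1 l, f (2 * i, 2 * l + 2) := by
  rw [show 2 * (l + 1) = 2 * l + 1 + 1 by ring, prod_evenPairs_succ, prod_evenPairs_succ,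
    prod_odd_indices (l := l) (fun i => by simp only [mem_Icc, Nat.even_iff]; omega)
      fun i => f (i, 2 * l + 1),
    prod_even_indices (l := l) (fun i => by simp only [mem_Icc, Nat.even_iff]; omega)
      fun i => f (i, 2 * l + 1 + 1)]

/-- The union of the intervals `[s (2i - 1), s (2i))` for `1 ≤ i ≤ l`. -/
def blocks (s : ℕ → ℕ) (l : ℕ) : Finset ℕ :=
  (Icc 1 l).biUnion fun i => Ico (s (2 * i - 1)) (s (2 * i))

theorem mem_blocks {s : ℕ → ℕ} {l x : ℕ} :
    x ∈ blocks s l ↔ ∃ i, 1 ≤ i ∧ i ≤ l ∧ s (2 * i - 1) ≤ x ∧ x < s (2 * i) := by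
  simp [blocks, and_assoc]

theorem blocks_succ (s : ℕ → ℕ) (l : ℕ) :
    blocks s (l + 1) = blocks s l ∪ Ico (s (2 * l + 1)) (s (2 * l + 2)) := by
  have : Icc 1 (l + 1) = insert (l + 1) (Icc 1 l) := by
    ext i; simp only [mem_Icc, mem_insert]; omega
  rw [blocks, this, biUnion_insert, union_comm]
  rfl

theorem lt_of_mem_blocks {s : ℕ → ℕ} (hs : Monotone s) {l x : ℕ} (hx : x ∈ blocks s l) :
    x < s (2 * l) := by
  obtain ⟨i, -, h2, -, h4⟩ := mem_blocks.1 hx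
  exact h4.trans_le (hs (by omega))

theorem blocks_pairwiseDisjoint {s : ℕ → ℕ} (hs : Monotone s) (l : ℕ) :
    (Set.Icc 1 l).PairwiseDisjoint fun i => Ico (s (2 * i - 1)) (s (2 * i)) := by
  intro i hi j hj hij
  simp only [Function.onFun]
  rw [disjoint_left]
  intro x h1 h2
  rw [mem_Ico] at h1 h2
  obtain ⟨hi, -⟩ := Set.mem_Icc.1 hi
  obtain ⟨hj, -⟩ := Set.mem_Icc.1 hj
  rcases lt_or_gt_of_ne hij with h | h
  · have := hs (show 2 * i ≤ 2 * j - 1 by omega)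
    omega
  · have := hs (show 2 * j ≤ 2 * i - 1 by omega)
    omega

theorem prod_blocks {s : ℕ → ℕ} (hs : Monotone s) (l : ℕ) (f : ℕ → ℚ) :
    ∏ x ∈ blocks s l, f x = ∏ i ∈ Icc 1 l, ∏ x ∈ Ico (s (2 * i - 1)) (s (2 * i)), f x :=
  prod_biUnion (by simpa using blocks_pairwiseDisjoint hs l)

/-- The product of `g x` over `X` and of `(y - x) (y + x + τ)` over the pairs `x < y` in `X`. -/
def pairProd (g : ℕ → ℚ) (τ : ℚ) (X : Finset ℕ) : ℚ :=
  (∏ x ∈ X, g x) * ∏ p ∈ X ×ˢ X with p.1 < p.2, (((p.2 : ℚ) - p.1) * (p.2 + p.1 + τ))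

theorem pairProd_insert {g : ℕ → ℚ} {τ : ℚ} {X : Finset ℕ} {b : ℕ} (hb : ∀ x ∈ X, x < b) :
    pairProd g τ (insert b X) =
      pairProd g τ X * (g b * ∏ x ∈ X, (((b : ℚ) - x) * (b + x + τ))) := by
  have hbX : b ∉ X := fun h => lt_irrefl _ (hb b h)
  have h : ({p ∈ insert b X ×ˢ insert b X | p.1 < p.2} : Finset (ℕ × ℕ)) =
      {p ∈ X ×ˢ X | p.1 < p.2} ∪ X.image fun x => (x, b) := by
    ext ⟨i, j⟩
    simp only [mem_filter, mem_product, mem_insert, mem_union, mem_image, Prod.mk.injEq]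
    constructor
    · rintro ⟨⟨hi, hj⟩, hij⟩
      rcases hj with rfl | hj
      · exact Or.inr ⟨i, hi.resolve_left (by omega), rfl, rfl⟩
      · have := hb j hj
        exact Or.inl ⟨⟨hi.resolve_left (by omega), hj⟩, hij⟩
    · rintro (⟨⟨hi, hj⟩, hij⟩ | ⟨x, hx, rfl, rfl⟩)
      · exact ⟨⟨Or.inr hi, Or.inr hj⟩, hij⟩
      · exact ⟨⟨Or.inr hx, Or.inl rfl⟩, hb x hx⟩
  rw [pairProd, pairProd, h, prod_insert hbX, prod_union, prod_image]
  · ring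
  · simp
  · rw [disjoint_left]
    rintro ⟨i, j⟩ h1 h2
    simp only [mem_filter, mem_product, mem_image, Prod.mk.injEq] at h1 h2
    obtain ⟨x, -, -, rfl⟩ := h2
    exact hbX h1.1.2

/-! ### Telescoping of pair products to hyperfactorials. -/

theorem hyper_succ (n : ℕ) : hyper (n + 1) = hyper n * n.factorial := by
  rw [hyper, prod_range_succ, ← hyper]

theorem hyper_ne_zero (n : ℕ) : (hyper n : ℚ) ≠ 0 := by
  rw [hyper, Nat.cast_ne_zero, prod_ne_zero_iff]
  exact fun i _ => i.factorial_ne_zero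

/-- `φ` is a shifted factorial and `h` the corresponding hyperfactorial; `ψ` and `χ` are the
factors that depend on the right and on the left end of an interval. -/
structure IsProductData (g φ h ψ χ : ℕ → ℚ) (τ : ℚ) : Prop where
  φ_ne_zero : ∀ n, φ n ≠ 0
  -- Positivity is needed for `τ = 0`, where `φ n = (n - 1)!` is truncated and `φ 0 = φ 1 = 1`.
  φ_succ : ∀ n, 0 < n → φ (n + 1) = φ n * (n + τ)
  h_ne_zero : ∀ n, h n ≠ 0
  h_succ : ∀ n, h (n + 1) = h n * φ n
  ψ_succ : ∀ n, ψ (n + 1) = ψ n * (g n * φ (2 * n))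
  ψ_mul_χ : ∀ n, ψ n * χ n = h (2 * n)

/-- The product formula in terms of the ends of the intervals. -/
noncomputable def endsProd (h ψ χ : ℕ → ℚ) (s : ℕ → ℕ) (l : ℕ) : ℚ :=
  (∏ i ∈ Icc 1 l, ψ (s (2 * i)) * χ (s (2 * i - 1))) *
  (∏ p ∈ oddPairs (2 * l), (hyper (s p.2 - s p.1) : ℚ) / h (s p.2 + s p.1)) *
  ∏ p ∈ evenPairs (2 * l), h (s p.2 + s p.1) / (hyper (s p.2 - s p.1) : ℚ)

/-- The factor by which an additional interval `[a, b)` changes `endsProd`. -/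
noncomputable def lastFactor (h ψ χ : ℕ → ℚ) (s : ℕ → ℕ) (l a b : ℕ) : ℚ :=
  ψ b * χ a * ((hyper (b - a) : ℚ) / h (b + a)) *
  ∏ i ∈ Icc 1 l, (((hyper (b - s (2 * i - 1)) : ℚ) / h (b + s (2 * i - 1))) *
      (h (b + s (2 * i)) / (hyper (b - s (2 * i)) : ℚ)) *
    ((h (a + s (2 * i - 1)) / (hyper (a - s (2 * i - 1)) : ℚ)) *
      ((hyper (a - s (2 * i)) : ℚ) / h (a + s (2 * i)))))

theorem endsProd_succ (h ψ χ : ℕ → ℚ) (s : ℕ → ℕ) (l : ℕ) :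
    endsProd h ψ χ s (l + 1) =
      endsProd h ψ χ s l * lastFactor h ψ χ s l (s (2 * l + 1)) (s (2 * l + 2)) := by
  rw [endsProd, endsProd, lastFactor, prod_Icc_succ_top (by omega), prod_oddPairs_add_two,
    prod_evenPairs_add_two]
  simp only [prod_mul_distrib]
  rw [show 2 * (l + 1) - 1 = 2 * l + 1 by omega, show 2 * (l + 1) = 2 * l + 2 by ring]
  ring

namespace IsProductData

variable {g φ h ψ χ : ℕ → ℚ} {τ : ℚ}

theorem prod_Ico (hd : IsProductData g φ h ψ χ τ) {a b c : ℕ} (hab : a ≤ b) (hbc : b ≤ c) :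
    ∏ x ∈ Ico a b, (((c : ℚ) - x) * (c + x + τ)) =
      (((c - a).factorial : ℚ) / φ (c + a)) * (φ (c + b) / ((c - b).factorial : ℚ)) := by
  induction b, hab using Nat.le_induction with
  | base =>
    have h1 := hd.φ_ne_zero (c + a)
    have h2 : ((c - a).factorial : ℚ) ≠ 0 := by exact_mod_cast Nat.factorial_ne_zero _
    simp
    field_simp
  | succ b hab ih =>
    have h1 : c - b = (c - (b + 1)) + 1 := by omega
    have h2 : ((c - (b + 1) : ℕ) : ℚ) = c - b - 1 := by
      rw [Nat.cast_sub hbc]; push_cast; ring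
    have h3 := Nat.factorial_ne_zero (c - (b + 1))
    have h4 := hd.φ_ne_zero (c + a)
    have h5 : (c : ℚ) - b ≠ 0 := by
      have : (b : ℚ) + 1 ≤ c := by exact_mod_cast hbc
      linarith
    rw [prod_Ico_succ_top hab, ih (by omega), ← add_assoc, hd.φ_succ (c + b) (by omega), h1,
      Nat.factorial_succ]
    push_cast
    rw [h2]
    have h6 : (c : ℚ) - b - 1 + 1 ≠ 0 := by simpa using h5
    field_simp
    ring

/-- For an empty interval the factors for `b` and for `a` are mutually inverse; `ψ_mul_χ` is what
makes the remaining diagonal factor equal to `1`. -/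
theorem lastFactor_self (hd : IsProductData g φ h ψ χ τ) (s : ℕ → ℕ) (l a : ℕ) :
    lastFactor h ψ χ s l a a = 1 := by
  rw [lastFactor, hd.ψ_mul_χ, prod_eq_one, ← two_mul]
  · have := hd.h_ne_zero (2 * a)
    simp [hyper]
    field_simp
  · intro i _
    have h1 := hd.h_ne_zero (a + s (2 * i))
    have h2 := hd.h_ne_zero (a + s (2 * i - 1))
    have h3 := hyper_ne_zero (a - s (2 * i))
    have h4 := hyper_ne_zero (a - s (2 * i - 1))
    field_simp

/-- Each hyperfactorial changes by one factorial, and by `prod_Ico` the quotients of these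
factorials are the products of the new element `b` with the earlier intervals. For the interval
ending at `b` the quotient contains `φ (2 * b)`, which comes from `ψ_succ`. -/
theorem lastFactor_succ (hd : IsProductData g φ h ψ χ τ) {s : ℕ → ℕ} (hs : Monotone s)
    {l a b : ℕ} (hla : s (2 * l) ≤ a) (hab : a ≤ b) :
    lastFactor h ψ χ s l a (b + 1) = lastFactor h ψ χ s l a b *
      (g b * ((∏ x ∈ blocks s l, (((b : ℚ) - x) * (b + x + τ))) *
        ∏ x ∈ Ico a b, (((b : ℚ) - x) * (b + x + τ)))) := by
  have hlast : ∀ i ∈ Icc 1 l, s (2 * i) ≤ b := fun i hi => by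
    have := hs (show 2 * i ≤ 2 * l by rw [mem_Icc] at hi; omega)
    omega
  rw [prod_blocks hs, hd.prod_Ico hab le_rfl, prod_congr rfl fun i hi =>
    hd.prod_Ico (hs (show 2 * i - 1 ≤ 2 * i by omega)) (hlast i hi), lastFactor, lastFactor]
  have hprod : ∀ i ∈ Icc 1 l,
      ((hyper (b + 1 - s (2 * i - 1)) : ℚ) / h (b + 1 + s (2 * i - 1))) *
          (h (b + 1 + s (2 * i)) / (hyper (b + 1 - s (2 * i)) : ℚ)) *
        ((h (a + s (2 * i - 1)) / (hyper (a - s (2 * i - 1)) : ℚ)) *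
          ((hyper (a - s (2 * i)) : ℚ) / h (a + s (2 * i)))) =
      ((hyper (b - s (2 * i - 1)) : ℚ) / h (b + s (2 * i - 1))) *
          (h (b + s (2 * i)) / (hyper (b - s (2 * i)) : ℚ)) *
        ((h (a + s (2 * i - 1)) / (hyper (a - s (2 * i - 1)) : ℚ)) *
          ((hyper (a - s (2 * i)) : ℚ) / h (a + s (2 * i)))) *
      ((((b - s (2 * i - 1)).factorial : ℚ) / φ (b + s (2 * i - 1))) *
        (φ (b + s (2 * i)) / ((b - s (2 * i)).factorial : ℚ))) := by
    intro i hi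
    have h1 := hlast i hi
    have h2 := hs (show 2 * i - 1 ≤ 2 * i by omega)
    rw [show b + 1 - s (2 * i - 1) = b - s (2 * i - 1) + 1 by omega,
      show b + 1 - s (2 * i) = b - s (2 * i) + 1 by omega,
      add_right_comm b 1 (s (2 * i - 1)), add_right_comm b 1 (s (2 * i)), hd.h_succ, hd.h_succ, hyper_succ, hyper_succ]
    push_cast
    rw [mul_div_mul_comm, mul_div_mul_comm]
    ring
  rw [prod_congr rfl hprod, prod_mul_distrib, show b + 1 - a = b - a + 1 by omega,
    add_right_comm, hd.h_succ, hyper_succ, hd.ψ_succ, two_mul]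
  push_cast
  rw [mul_div_mul_comm, Nat.sub_self, Nat.factorial_zero, Nat.cast_one, div_one]
  ring

theorem endsProd_eq_pairProd (hd : IsProductData g φ h ψ χ τ) {s : ℕ → ℕ} (hs : Monotone s)
    (l : ℕ) : endsProd h ψ χ s l = pairProd g τ (blocks s l) := by
  induction l with
  | zero => simp [endsProd, pairProd, blocks, oddPairs, evenPairs]
  | succ l ih =>
    rw [endsProd_succ, ih, blocks_succ]
    have hla : s (2 * l) ≤ s (2 * l + 1) := hs (by omega)
    have hab : s (2 * l + 1) ≤ s (2 * l + 2) := hs (by omega)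
    generalize s (2 * l + 1) = a at *
    generalize s (2 * l + 2) = b at *
    have hlt : ∀ x ∈ blocks s l, x < a := fun x hx => (lt_of_mem_blocks hs hx).trans_le hla
    -- The last interval is built up one element at a time from the empty one.
    induction b, hab using Nat.le_induction with
    | base => rw [hd.lastFactor_self, mul_one, Ico_self, union_empty]
    | succ b hab ih =>
      have hX : ∀ x ∈ blocks s l ∪ Ico a b, x < b := by
        intro x hx
        rcases mem_union.1 hx with hx | hx
        · exact (hlt x hx).trans_le hab
        · exact (mem_Ico.1 hx).2
      have hdisj : Disjoint (blocks s l) (Ico a b) := by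
        rw [disjoint_left]
        intro x hx hx'
        have := hlt x hx
        rw [mem_Ico] at hx'
        omega
      have hI : blocks s l ∪ Ico a (b + 1) = insert b (blocks s l ∪ Ico a b) := by
        ext x
        have : (a ≤ x ∧ x < b + 1) ↔ (x = b ∨ a ≤ x ∧ x < b) := by omega
        simp only [mem_union, mem_insert, mem_Ico, this]
        tauto
      rw [hI, pairProd_insert hX, ← ih, hd.lastFactor_succ hs hla hab, prod_union hdisj]
      ring

end IsProductData

/-! ### Cells and triangles -/

/-- The unit triangle with cell `(c, y)`; the offset `δ` shifts the cells by `(δ, -δ)`. -/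
def cellTri (δ : ℤ) (p : ℤ × ℤ) : Tri :=
  if (p.1 - p.2) % 2 = 1 then ((p.1 - p.2 - 1) / 2 + δ, p.2 - δ, true)
  else ((p.1 - p.2 - 2) / 2 + δ, p.2 - δ, false)

theorem cellTri_eq_up {δ c y x y' : ℤ} :
    cellTri δ (c, y) = (x, y', true) ↔ c = 2 * x + y' + 1 - δ ∧ y = y' + δ := by
  unfold cellTri
  split_ifs with h
  · simp only [Prod.mk.injEq, and_true]
    simp only at h
    omega
  · simp only [Prod.mk.injEq, Bool.false_eq_true, and_false, false_iff]
    simp only at h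
    omega

theorem cellTri_eq_down {δ c y x y' : ℤ} :
    cellTri δ (c, y) = (x, y', false) ↔ c = 2 * x + y' + 2 - δ ∧ y = y' + δ := by
  unfold cellTri
  split_ifs with h
  · simp only [Prod.mk.injEq, Bool.true_eq_false, and_false, false_iff]
    simp only at h
    omega
  · simp only [Prod.mk.injEq, and_true]
    simp only at h
    omega

theorem cellTri_injective (δ : ℤ) : Function.Injective (cellTri δ) := by
  rintro ⟨c, y⟩ ⟨c', y'⟩ h
  generalize hT : cellTri δ (c', y') = T at h
  obtain ⟨x, z, b⟩ := T
  cases b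
  · rw [cellTri_eq_down] at h hT
    rw [Prod.mk.injEq]
    omega
  · rw [cellTri_eq_up] at h hT
    rw [Prod.mk.injEq]
    omega

theorem shareEdge_cellTri_of_odd {δ c y c' y' : ℤ} (h : Odd (c - y)) :
    ShareEdge (cellTri δ (c, y)) (cellTri δ (c', y')) ↔
      (y' = y ∧ (c' = c + 1 ∨ c' = c - 1)) ∨ (c' = c ∧ y' = y - 1) := by
  rw [Int.odd_iff] at h
  unfold cellTri
  simp only [h, if_true]
  split_ifs with h'
  · simp only [not_shareEdge_up_up, false_iff]
    omega
  · rw [shareEdge_up_down]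
    omega

theorem shareEdge_cellTri_of_even {δ c y c' y' : ℤ} (h : Even (c - y)) :
    ShareEdge (cellTri δ (c, y)) (cellTri δ (c', y')) ↔
      (y' = y ∧ (c' = c + 1 ∨ c' = c - 1)) ∨ (c' = c ∧ y' = y + 1) := by
  rw [Int.even_iff] at h
  unfold cellTri
  simp only [h, zero_ne_one, if_false]
  split_ifs with h'
  · rw [shareEdge_down_up]
    omega
  · simp only [not_shareEdge_down_down, false_iff]
    omega

theorem weightedCount_image_eq_sum (w : Finset Tri → ℚ) (δ : ℤ) {R : Finset (ℤ × ℤ)}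
    {p : ℤ × ℤ} (hp : p ∈ R) :
    weightedCount w (R.image (cellTri δ)) =
      ∑ q ∈ R with ShareEdge (cellTri δ p) (cellTri δ q),
        w {cellTri δ p, cellTri δ q} * weightedCount w ((R \ {p, q}).image (cellTri δ)) := by
  rw [weightedCount_eq_sum w (mem_image_of_mem _ hp), filter_image,
    sum_image ((cellTri_injective δ).injOn)]
  refine sum_congr rfl fun q _ => ?_
  rw [image_sdiff _ _ (cellTri_injective δ), image_insert, image_singleton]

/-- An up-pointing cell has its neighbours to the left, to the right and below, a down-pointing one
to the left, to the right and above; the expansion along a triangle keeps those still present. -/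
theorem isCellCount_weightedCount (w : Finset Tri → ℚ) (δ : ℤ)
    (hw : ∀ c y, w {cellTri δ (c, y), cellTri δ (c + 1, y)} = 1) :
    IsCellCount (fun R => weightedCount w (R.image (cellTri δ)))
      (fun c y => w {cellTri δ (c, y), cellTri δ (c, y + 1)}) where
  empty := by simp [weightedCount_empty]
  up R c y hR hodd h1 h2 := by
    rw [weightedCount_image_eq_sum w δ hR]
    split_ifs with h
    · rw [show ({q ∈ R | ShareEdge (cellTri δ (c, y)) (cellTri δ q)} : Finset (ℤ × ℤ)) =
        {(c + 1, y)} from ?_, sum_singleton, hw, one_mul]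
      ext ⟨c', y'⟩
      rw [mem_filter, shareEdge_cellTri_of_odd hodd, mem_singleton, Prod.mk.injEq]
      constructor
      · rintro ⟨hq, ⟨rfl, rfl | rfl⟩ | ⟨rfl, rfl⟩⟩
        · exact ⟨rfl, rfl⟩
        · exact absurd hq h1
        · exact absurd hq h2
      · rintro ⟨rfl, rfl⟩
        exact ⟨h, by simp⟩
    · refine sum_eq_zero fun q hq => ?_
      obtain ⟨c', y'⟩ := q
      rw [mem_filter, shareEdge_cellTri_of_odd hodd] at hq
      obtain ⟨hq, ⟨rfl, rfl | rfl⟩ | ⟨rfl, rfl⟩⟩ := hq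
      · exact absurd hq h
      · exact absurd hq h1
      · exact absurd hq h2
  down R c y hR heven h1 := by
    rw [weightedCount_image_eq_sum w δ hR]
    have hF : ({q ∈ R | ShareEdge (cellTri δ (c, y)) (cellTri δ q)} : Finset (ℤ × ℤ)) =
        {q ∈ ({(c + 1, y), (c, y + 1)} : Finset (ℤ × ℤ)) | q ∈ R} := by
      ext ⟨c', y'⟩
      rw [mem_filter, mem_filter, shareEdge_cellTri_of_even heven, mem_insert, mem_singleton,
        Prod.mk.injEq, Prod.mk.injEq]
      constructor
      · rintro ⟨hq, ⟨rfl, rfl | rfl⟩ | ⟨rfl, rfl⟩⟩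
        · exact ⟨by simp, hq⟩
        · exact absurd hq h1
        · exact ⟨by simp, hq⟩
      · rintro ⟨⟨rfl, rfl⟩ | ⟨rfl, rfl⟩, hq⟩ <;> exact ⟨hq, by simp⟩
    rw [hF, sum_filter, sum_pair (by simp), hw, one_mul]

/-! ### Partial sums and the removed triangles -/

section Sequences

variable {l : ℕ} (t : Fin (2 * l) → ℕ)

theorem psum_eq_sum_range (k : ℕ) :
    psum t k = ∑ n ∈ range k, if h : n < 2 * l then t ⟨n, h⟩ else 0 := by
  induction k with
  | zero => simp [psum]
  | succ k ih =>
    rw [sum_range_succ, ← ih]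
    unfold psum
    split_ifs with h
    · rw [show ({j | j.val < k + 1} : Finset (Fin (2 * l))) =
        insert ⟨k, h⟩ ({j | j.val < k} : Finset (Fin (2 * l))) from ?_, sum_insert (by simp),
        add_comm]
      ext j
      simp only [mem_filter, mem_univ, true_and, mem_insert, Fin.ext_iff]
      omega
    · rw [add_zero]
      refine sum_congr ?_ fun _ _ => rfl
      ext j
      simp only [mem_filter, mem_univ, true_and]
      omega

theorem psum_mono : Monotone (psum t) := by
  intro a b hab
  rw [psum_eq_sum_range, psum_eq_sum_range]
  exact sum_le_sum_of_subset (range_subset_range.2 hab)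

theorem psum_succ {k : ℕ} (h : k < 2 * l) : psum t (k + 1) = psum t k + t ⟨k, h⟩ := by
  rw [psum_eq_sum_range, sum_range_succ, ← psum_eq_sum_range, dif_pos h]

theorem card_blocks : #(blocks (psum t) l) = evenSum t := by
  rw [blocks, card_biUnion (by simpa using blocks_pairwiseDisjoint (psum_mono t) l), evenSum,
    sum_fin_eq_sum_range, ← Ico_add_one_right_eq_Icc, sum_Ico_eq_sum_range]
  refine sum_congr rfl fun i hi => ?_
  rw [mem_range] at hi
  rw [Nat.card_Ico, dif_pos hi, show 2 * (1 + i) = 2 * i + 1 + 1 by ring,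
    psum_succ t (show 2 * i + 1 < 2 * l by omega)]
  simp

theorem psum_two_mul : psum t (2 * l) = evenSum t + oddSum t := by
  have h : ∀ k, psum t (2 * k) = ∑ i ∈ range k, ((if h : 2 * i + 1 < 2 * l then
      t ⟨2 * i + 1, h⟩ else 0) + if h : 2 * i < 2 * l then t ⟨2 * i, h⟩ else 0) := by
    intro k
    rw [psum_eq_sum_range]
    induction k with
    | zero => simp
    | succ k ih =>
      rw [show 2 * (k + 1) = 2 * k + 1 + 1 by ring, sum_range_succ, sum_range_succ, ih,
        sum_range_succ, add_assoc, add_comm (dite (2 * k < 2 * l) _ _)]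
  rw [h, sum_add_distrib, evenSum, oddSum, sum_fin_eq_sum_range, sum_fin_eq_sum_range]
  congr 1 <;> refine sum_congr rfl fun i hi => ?_ <;> rw [mem_range] at hi
  · rw [dif_pos hi, dif_pos (by omega)]
  · rw [dif_pos hi, dif_pos (by omega)]

theorem inBaseTriangle_up {a k : ℕ} {x y : ℤ} :
    InBaseTriangle a k (x, y, true) ↔ 0 ≤ y ∧ a ≤ x ∧ x + y + 1 ≤ a + k := by
  unfold InBaseTriangle
  simp only [mem_verts_up, forall_eq_or_imp, forall_eq]
  omega

theorem inBaseTriangle_down {a k : ℕ} {x y : ℤ} :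
    InBaseTriangle a k (x, y, false) ↔ 0 ≤ y ∧ a ≤ x ∧ x + y + 2 ≤ a + k := by
  unfold InBaseTriangle
  simp only [mem_verts_down, forall_eq_or_imp, forall_eq]
  omega

theorem mem_trapezoid_up {west : ℤ → ℤ} {m N : ℕ} {x y : ℤ} :
    (x, y, true) ∈ trapezoid west m N ↔ -(m : ℤ) ≤ x ∧ 0 ≤ y ∧ y < m ∧ x + y + 1 ≤ N ∧
      west y ≤ x ∧ west (y + 1) ≤ x := by
  unfold trapezoid
  simp only [mem_filter, mem_product, mem_Icc, mem_Ico, mem_univ, and_true, mem_verts_up,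
    forall_eq_or_imp, forall_eq]
  omega

theorem mem_trapezoid_down {west : ℤ → ℤ} {m N : ℕ} {x y : ℤ} :
    (x, y, false) ∈ trapezoid west m N ↔ -(m : ℤ) ≤ x ∧ 0 ≤ y ∧ y < m ∧ x + y + 2 ≤ N ∧
      west y ≤ x + 1 ∧ west (y + 1) ≤ x := by
  unfold trapezoid
  simp only [mem_filter, mem_product, mem_Icc, mem_Ico, mem_univ, and_true, mem_verts_down,
    forall_eq_or_imp, forall_eq]
  omega

/-- Removing the big triangles is the same as removing only the unit triangles on their bases:
the rest of each big triangle is covered by forced vertical lozenges. -/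
theorem weightedCount_removeTriangles (w : Finset Tri → ℚ) {west : ℤ → ℤ} {m : ℕ}
    (hwest : ∀ y, 0 ≤ y → west y ≤ 0) (hm : evenSum t ≤ m)
    (hw : ∀ x y : ℤ, 0 ≤ x → 0 ≤ y → w {(x, y, false), (x, y + 1, true)} = 1) :
    weightedCount w (removeTriangles t (trapezoid west m (evenSum t + oddSum t))) =
      weightedCount w (trapezoid west m (evenSum t + oddSum t) \
        (blocks (psum t) l).image fun x : ℕ => ((x : ℤ), (0 : ℤ), true)) := by
  classical
  have hs := psum_mono t
  set N := evenSum t + oddSum t with hN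
  set B : Tri → Prop := fun p => ∃ i : Fin l,
    InBaseTriangle (psum t (2 * i.val + 1)) (t ⟨2 * i.val + 1, by omega⟩) p with hB
  have htE : ∀ i : Fin l, t ⟨2 * i.val + 1, by omega⟩ ≤ evenSum t := fun i =>
    single_le_sum (f := fun i : Fin l => t ⟨2 * i.val + 1, by omega⟩)
      (fun _ _ => Nat.zero_le _) (mem_univ i)
  have hps : ∀ i : Fin l, psum t (2 * i.val + 1 + 1) =
      psum t (2 * i.val + 1) + t ⟨2 * i.val + 1, by omega⟩ := fun i => psum_succ t (by omega)
  have hsN : ∀ i : Fin l, psum t (2 * i.val + 1 + 1) ≤ N := fun i => by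
    rw [hN, ← psum_two_mul]
    exact hs (by omega)
  set T := trapezoid west m N with hT
  have hBup : ∀ x y, B (x, y, true) → 0 ≤ x ∧ 0 ≤ y ∧ (x, y, true) ∈ T := by
    rintro x y ⟨i, hi⟩
    rw [inBaseTriangle_up] at hi
    have h1 := htE i
    have h2 := hps i
    have h3 := hsN i
    have h4 := hwest y hi.1
    have h5 := hwest (y + 1) (by omega)
    rw [hT, mem_trapezoid_up]
    omega
  have hBdown : ∀ x y, B (x, y, false) → 0 ≤ x ∧ 0 ≤ y ∧ (x, y, false) ∈ T := by
    rintro x y ⟨i, hi⟩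
    rw [inBaseTriangle_down] at hi
    have h1 := htE i
    have h2 := hps i
    have h3 := hsN i
    have h4 := hwest y hi.1
    have h5 := hwest (y + 1) (by omega)
    rw [hT, mem_trapezoid_down]
    omega
  have hBvert : ∀ x y, 0 ≤ y → (B (x, y + 1, true) ↔ B (x, y, false)) := by
    intro x y hy
    simp only [hB, inBaseTriangle_up, inBaseTriangle_down]
    refine exists_congr fun i => ?_
    omega
  have hBside : ∀ x y, B (x, y, false) → B (x, y, true) ∧ B (x + 1, y, true) := by
    rintro x y ⟨i, hi⟩
    simp only [hB, inBaseTriangle_up]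
    rw [inBaseTriangle_down] at hi
    exact ⟨⟨i, by omega⟩, ⟨i, by omega⟩⟩
  have hBbase : ∀ x : ℤ, B (x, 0, true) ↔ ∃ n ∈ blocks (psum t) l, (n : ℤ) = x := by
    intro x
    simp only [hB, inBaseTriangle_up, mem_blocks]
    constructor
    · rintro ⟨i, hi⟩
      have h2 := hps i
      refine ⟨x.toNat, ⟨i.val + 1, by omega, by omega, ?_, ?_⟩, by omega⟩
      · rw [show 2 * (i.val + 1) - 1 = 2 * i.val + 1 by omega]
        omega
      · rw [show 2 * (i.val + 1) = 2 * i.val + 1 + 1 by omega]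
        omega
    · rintro ⟨n, ⟨i, h1, h2, h3, h4⟩, rfl⟩
      have h5 := hps ⟨i - 1, by omega⟩
      simp only at h5
      refine ⟨⟨i - 1, by omega⟩, le_rfl, ?_, ?_⟩ <;> simp only
      · rw [show 2 * (i - 1) + 1 = 2 * i - 1 by omega]
        omega
      · rw [show 2 * (i - 1) + 1 + 1 = 2 * i by omega] at h5
        omega
  set D := (blocks (psum t) l).image fun x : ℕ => ((x : ℤ), (0 : ℤ), true) with hD
  have hDmem : ∀ x y b, (x, y, b) ∈ D ↔ y = 0 ∧ b = true ∧ B (x, 0, true) := by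
    intro x y b
    rw [hBbase, hD, mem_image]
    simp only [Prod.mk.injEq]
    constructor
    · rintro ⟨n, hn, h1, h2, h3⟩
      exact ⟨h2.symm, h3.symm, n, hn, h1⟩
    · rintro ⟨h2, h3, n, hn, h1⟩
      exact ⟨n, hn, h1, h2.symm, h3.symm⟩
  -- Each down-pointing triangle inside a big triangle is paired with the up-pointing one on top of
  -- it.
  let f : Tri → Tri := fun p => (p.1, p.2.1 + 1, !p.2.2)
  have hf : Function.Injective f := by
    rintro ⟨x, y, b⟩ ⟨x', y', b'⟩ h
    simp only [f, Prod.mk.injEq, add_left_inj, Bool.not_inj_iff] at h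
    simp [h]
  let X : Finset Tri := {p ∈ T | p.2.2 = false ∧ B p}
  have hX : ∀ x y b, (x, y, b) ∈ X ↔ b = false ∧ B (x, y, b) := by
    intro x y b
    simp only [X, mem_filter]
    constructor
    · rintro ⟨-, h⟩
      exact h
    · rintro ⟨rfl, h⟩
      exact ⟨(hBdown x y h).2.2, rfl, h⟩
  have hfX : ∀ x y b, (x, y, b) ∈ X.image f ↔ b = true ∧ 0 < y ∧ B (x, y, true) := by
    intro x y b
    rw [mem_image]
    constructor
    · rintro ⟨⟨x', y', b'⟩, hp, he⟩
      rw [hX] at hp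
      obtain ⟨rfl, hp⟩ := hp
      simp only [f, Prod.mk.injEq, Bool.not_false] at he
      obtain ⟨rfl, rfl, rfl⟩ := he
      have := (hBdown _ _ hp).2.1
      exact ⟨rfl, by omega, (hBvert _ _ this).2 hp⟩
    · rintro ⟨rfl, hy, hb⟩
      refine ⟨(x, y - 1, false), (hX _ _ _).2 ⟨rfl, ?_⟩, by simp [f]⟩
      rw [← hBvert _ _ (by omega), sub_add_cancel]
      exact hb
  symm
  rw [weightedCount_forced w f hf X]
  · congr 1
    ext ⟨x, y, b⟩
    simp only [removeTriangles, mem_sdiff, mem_union, mem_filter, hDmem, hX, hfX]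
    have hrem : (∀ i : Fin l, ¬ InBaseTriangle (psum t (2 * i.val + 1))
        (t ⟨2 * i.val + 1, by omega⟩) (x, y, b)) ↔ ¬ B (x, y, b) := by
      simp [hB]
    rw [hrem]
    cases b
    · simp
    · simp only [Bool.true_eq_false, false_and, false_or, true_and, and_assoc]
      refine and_congr_right fun _ => ?_
      constructor
      · rintro ⟨h1, h2⟩ h
        rcases (hBup x y h).2.1.eq_or_lt with h0 | h0
        · exact h1 ⟨h0.symm, by rwa [h0]⟩
        · exact h2 ⟨h0, h⟩
      · intro h
        refine ⟨?_, fun h' => h h'.2⟩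
        rintro ⟨rfl, h'⟩
        exact h h'
  · rintro ⟨x, y, b⟩ hp
    rw [hX] at hp
    obtain ⟨rfl, hp⟩ := hp
    rw [mem_sdiff, hDmem]
    exact ⟨(hBdown x y hp).2.2, by simp⟩
  · rintro ⟨x, y, b⟩ hp
    rw [hfX] at hp
    obtain ⟨rfl, hy, hp⟩ := hp
    rw [mem_sdiff, hDmem]
    exact ⟨(hBup x y hp).2.2, by omega⟩
  · rw [disjoint_left]
    rintro ⟨x, y, b⟩ h1 h2
    rw [hX] at h1
    rw [hfX] at h2
    simp [h1.1] at h2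
  · rintro ⟨x, y, b⟩ hp
    rw [hX] at hp
    obtain ⟨rfl, -⟩ := hp
    simp [f, shareEdge_down_up]
  · rintro ⟨x, y, b⟩ hp
    rw [hX] at hp
    obtain ⟨rfl, hp⟩ := hp
    exact hw x y (hBdown x y hp).1 (hBdown x y hp).2.1
  · rintro ⟨x, y, b⟩ hp ⟨x', y', b'⟩ hq hpq hne
    rw [hX] at hp
    obtain ⟨rfl, hp⟩ := hp
    cases b' with
    | false => exact absurd hpq (not_shareEdge_down_down _ _ _ _)
    | true =>
      rw [shareEdge_down_up] at hpq
      have hy0 := (hBdown x y hp).2.1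
      have hup : y' = y ∧ B (x', y', true) := by
        rcases hpq with ⟨rfl, rfl⟩ | ⟨rfl, rfl⟩ | ⟨rfl, rfl⟩
        · exact ⟨rfl, (hBside _ _ hp).1⟩
        · exact ⟨rfl, (hBside _ _ hp).2⟩
        · exact absurd rfl hne
      obtain ⟨rfl, hup⟩ := hup
      rw [mem_sdiff, hDmem] at hq
      -- A competing neighbour is up-pointing in the same row and in a big triangle. In row `0` it
      -- is a removed dent; in a higher row it is already the partner of the triangle below it.
      have hypos : 0 < y' := by
        rcases hy0.eq_or_lt with h0 | h0
        · subst h0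
          exact absurd ⟨rfl, rfl, hup⟩ hq.2
        · exact h0
      refine ⟨(x', y' - 1, false), (hX _ _ _).2 ⟨rfl, ?_⟩, by simp, by simp [f]⟩
      rw [← hBvert _ _ (by omega), sub_add_cancel]
      exact hup

end Sequences

/-! ### The two families of regions -/

theorem mem_dentedRegion {N m y : ℤ} {A : Finset ℤ} {p : ℤ × ℤ} :
    p ∈ dentedRegion N m y A ↔ 0 ≤ p.1 ∧ y ≤ p.2 ∧ p.2 < m ∧ p.1 < 2 * N - p.2 ∧
      (p.2 = y → p.1 ∉ A) := by
  rw [dentedRegion, mem_rowState]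
  simp only [notMem_empty, not_false_eq_true, implies_true, and_true]
  constructor
  · rintro ⟨h1, h2, h3, h4, h5⟩
    exact ⟨h1, h2, h3, h4, fun h => (h5 h).2⟩
  · rintro ⟨h1, h2, h3, h4, h5⟩
    exact ⟨h1, h2, h3, h4, fun h => ⟨h1, h5 h⟩⟩

theorem mem_image_cellTri_up {δ x y : ℤ} {R : Finset (ℤ × ℤ)} :
    (x, y, true) ∈ R.image (cellTri δ) ↔ (2 * x + y + 1 - δ, y + δ) ∈ R := by
  rw [mem_image]
  constructor
  · rintro ⟨⟨c, z⟩, h, he⟩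
    obtain ⟨rfl, rfl⟩ := cellTri_eq_up.1 he
    exact h
  · exact fun h => ⟨_, h, cellTri_eq_up.2 ⟨rfl, rfl⟩⟩

theorem mem_image_cellTri_down {δ x y : ℤ} {R : Finset (ℤ × ℤ)} :
    (x, y, false) ∈ R.image (cellTri δ) ↔ (2 * x + y + 2 - δ, y + δ) ∈ R := by
  rw [mem_image]
  constructor
  · rintro ⟨⟨c, z⟩, h, he⟩
    obtain ⟨rfl, rfl⟩ := cellTri_eq_down.1 he
    exact h
  · exact fun h => ⟨_, h, cellTri_eq_down.2 ⟨rfl, rfl⟩⟩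

theorem mem_image_dents {X : Finset ℕ} {x y : ℤ} {b : Bool} :
    (x, y, b) ∈ X.image (fun x : ℕ => ((x : ℤ), (0 : ℤ), true)) ↔
      y = 0 ∧ b = true ∧ ∃ n ∈ X, (n : ℤ) = x := by
  rw [mem_image]
  constructor
  · rintro ⟨n, hn, he⟩
    simp only [Prod.mk.injEq] at he
    exact ⟨he.2.1.symm, he.2.2.symm, n, hn, he.1⟩
  · rintro ⟨rfl, rfl, n, hn, rfl⟩
    exact ⟨n, hn, rfl⟩

/-- A trapezoid without the unit triangles of its base at the positions in `X` is a set of cells,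
if its western side is the vertical line through the cells with `c = δ`. -/
theorem trapezoid_sdiff_eq_image {west : ℤ → ℤ} {m N : ℕ} {δ M : ℤ} (X : Finset ℕ)
    (hM : M = m + δ)
    (hup : ∀ x y : ℤ, 0 ≤ y → y < m →
      ((-(m : ℤ) ≤ x ∧ west y ≤ x ∧ west (y + 1) ≤ x) ↔ 0 ≤ 2 * x + y + 1 - δ))
    (hdown : ∀ x y : ℤ, 0 ≤ y → y < m →
      ((-(m : ℤ) ≤ x ∧ west y ≤ x + 1 ∧ west (y + 1) ≤ x) ↔ 0 ≤ 2 * x + y + 2 - δ)) :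
    trapezoid west m N \ X.image (fun x : ℕ => ((x : ℤ), (0 : ℤ), true)) =
      (dentedRegion N M δ (X.image fun n : ℕ => 2 * (n : ℤ) + 1 - δ)).image (cellTri δ) := by
  ext ⟨x, y, b⟩
  rw [mem_sdiff, mem_image_dents]
  cases b
  · rw [mem_image_cellTri_down, mem_trapezoid_down, mem_dentedRegion]
    simp only [Bool.false_eq_true, false_and, and_false, not_false_eq_true, and_true]
    constructor
    · rintro ⟨h1, h2, h3, h4, h5, h6⟩
      have h0 := (hdown x y h2 h3).1 ⟨h1, h5, h6⟩
      refine ⟨h0, by omega, by omega, by omega, fun hy hA => ?_⟩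
      obtain ⟨n, -, hn⟩ := mem_image.1 hA
      omega
    · rintro ⟨h1, h2, h3, h4, -⟩
      have h0 := (hdown x y (by omega) (by omega)).2 h1
      exact ⟨h0.1, by omega, by omega, by omega, h0.2⟩
  · rw [mem_image_cellTri_up, mem_trapezoid_up, mem_dentedRegion]
    simp only [true_and]
    have hA : 2 * x + y + 1 - δ ∈ X.image (fun n : ℕ => 2 * (n : ℤ) + 1 - δ) ↔
        ∃ n ∈ X, 2 * (n : ℤ) = 2 * x + y := by
      rw [mem_image]
      refine exists_congr fun n => and_congr_right fun _ => ?_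
      omega
    rw [hA]
    constructor
    · rintro ⟨⟨h1, h2, h3, h4, h5, h6⟩, h7⟩
      have h0 := (hup x y h2 h3).1 ⟨h1, h5, h6⟩
      refine ⟨h0, by omega, by omega, by omega, fun hy => ?_⟩
      rintro ⟨n, hn, hnx⟩
      exact h7 ⟨by omega, n, hn, by omega⟩
    · rintro ⟨h1, h2, h3, h4, h5⟩
      have h0 := (hup x y (by omega) (by omega)).2 h1
      refine ⟨⟨h0.1, by omega, by omega, by omega, h0.2⟩, ?_⟩
      rintro ⟨hy, n, hn, hnx⟩
      exact h5 (by omega) ⟨n, hn, by omega⟩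

/-! ### Determinants as products over the set of dents -/

theorem prod_orderEmbOfFin_pairs {X : Finset ℕ} {k : ℕ} (hX : #X = k) (F : ℕ → ℕ → ℚ) :
    ∏ i, ∏ j ∈ Ioi i, F (X.orderEmbOfFin hX i) (X.orderEmbOfFin hX j) =
      ∏ p ∈ X ×ˢ X with p.1 < p.2, F p.1 p.2 := by
  have himg : univ.map (X.orderEmbOfFin hX).toEmbedding = X := by
    rw [map_eq_image]
    exact image_orderEmbOfFin_univ X hX
  rw [prod_filter, prod_product]
  conv_rhs => rw [← himg]
  rw [prod_map]
  refine prod_congr rfl fun i _ => ?_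
  rw [prod_map, ← filter_lt_eq_Ioi, prod_filter]
  simp

/-- These are the factors `4` in `(2 n + τ) ^ 2 - (2 n' + τ) ^ 2`; they cancel the powers of `4` in
`evenConst` and `oddConst`. -/
theorem prod_Ioi_four (k : ℕ) :
    ∏ i : Fin k, ∏ _j ∈ Ioi i, (4 : ℚ) = ∏ i ∈ range k, (4 : ℚ) ^ i := by
  simp only [prod_const, Fin.card_Ioi]
  rw [Fin.prod_univ_eq_prod_range (fun i => (4 : ℚ) ^ (k - 1 - i))]
  exact prod_range_reflect (fun i => (4 : ℚ) ^ i) k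

theorem prod_orderEmbOfFin_sq_sub {X : Finset ℕ} {k : ℕ} (hX : #X = k) (τ : ℚ) :
    ∏ i, ∏ j ∈ Ioi i, ((2 * (X.orderEmbOfFin hX j : ℚ) + τ) ^ 2 -
      (2 * (X.orderEmbOfFin hX i : ℚ) + τ) ^ 2) =
      (∏ i ∈ range k, (4 : ℚ) ^ i) * pairProd (fun _ => 1) τ X := by
  rw [pairProd, prod_const_one, one_mul,
    ← prod_orderEmbOfFin_pairs hX fun a b => ((b : ℚ) - a) * (b + a + τ), ← prod_Ioi_four,
    ← prod_mul_distrib]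
  refine prod_congr rfl fun i _ => ?_
  rw [← prod_mul_distrib]
  refine prod_congr rfl fun j _ => ?_
  ring

theorem prod_orderEmbOfFin {X : Finset ℕ} {k : ℕ} (hX : #X = k) (g : ℕ → ℚ) :
    ∏ i, g (X.orderEmbOfFin hX i) = ∏ x ∈ X, g x := by
  have himg : univ.map (X.orderEmbOfFin hX).toEmbedding = X := by
    rw [map_eq_image]
    exact image_orderEmbOfFin_univ X hX
  conv_rhs => rw [← himg]
  rw [prod_map]
  rfl

theorem evenConst_mul (k : ℕ) :
    evenConst k * ∏ i ∈ range k, (4 : ℚ) ^ i = 1 / (hyperSkip (2 * k) : ℚ) := by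
  rw [evenConst, ← prod_mul_distrib, hyperSkip, one_div, Nat.cast_prod, ← prod_inv_distrib,
    Nat.mul_div_cancel_left k (by norm_num), Nat.mul_mod_right]
  refine prod_congr rfl fun i _ => ?_
  rw [mul_inv, mul_right_comm, inv_mul_cancel₀ (by positivity), one_mul, add_zero]

theorem oddConst_mul (k : ℕ) :
    oddConst k * ∏ i ∈ range k, (4 : ℚ) ^ i =
      (1 / 2) ^ k / (hyperSkip (2 * k + 1) : ℚ) := by
  rw [oddConst, ← prod_mul_distrib, hyperSkip, div_eq_mul_inv _ (Nat.cast _), Nat.cast_prod,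
    ← prod_inv_distrib, show (2 * k + 1) / 2 = k by omega, show (2 * k + 1) % 2 = 1 by omega,
    show (1 / 2 : ℚ) ^ k = ∏ _i ∈ range k, (1 / 2 : ℚ) by simp, ← prod_mul_distrib]
  refine prod_congr rfl fun i _ => ?_
  have h4 : (4 : ℚ) ^ i ≠ 0 := by positivity
  have h5 : (((2 * i + 1).factorial : ℕ) : ℚ) ≠ 0 := by
    exact_mod_cast Nat.factorial_ne_zero _
  field_simp

theorem pairProd_eq_mul (g : ℕ → ℚ) (τ : ℚ) (X : Finset ℕ) :
    pairProd g τ X = (∏ x ∈ X, g x) * pairProd (fun _ => 1) τ X := by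
  simp [pairProd]

section Counts

variable {l : ℕ} (t : Fin (2 * l) → ℕ)

theorem lt_of_mem_blocks_psum {x : ℕ} (hx : x ∈ blocks (psum t) l) :
    x < evenSum t + oddSum t :=
  psum_two_mul t ▸ lt_of_mem_blocks (psum_mono t) hx

theorem image_orderEmbOfFin_affine {X : Finset ℕ} {k : ℕ} (hX : #X = k) (f : ℕ → ℤ) :
    (univ.image fun i => f (X.orderEmbOfFin hX i)) = X.image f := by
  conv_rhs => rw [← image_orderEmbOfFin_univ X hX, image_image]
  rfl

/-- The weighted number of tilings of `𝒬(t)`, as a product over the dents. -/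
theorem weightedCount_regionQ (w : Finset Tri → ℚ) {σ : ℚ}
    (hw : ∀ x y : ℤ, 0 ≤ x → 0 ≤ y → w {(x, y, false), (x, y + 1, true)} = 1)
    (hw' : ∀ c y, w {cellTri 0 (c, y), cellTri 0 (c + 1, y)} = 1)
    (hv : IsBoundaryWeight (fun c y => w {cellTri 0 (c, y), cellTri 0 (c, y + 1)}) σ 0
      (2 * evenSum t : ℕ)) :
    weightedCount w (regionQ t) =
      (1 / 2) ^ evenSum t / (hyperSkip (2 * evenSum t + 1) : ℚ) *
        pairProd (fun x => 2 * x + (1 + σ)) (1 + σ) (blocks (psum t) l) := by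
  have hX := card_blocks t
  set X := blocks (psum t) l with hXdef
  rw [regionQ, weightedCount_removeTriangles t w (fun y hy => by unfold westQ; omega) (by omega)
    hw, trapezoid_sdiff_eq_image (δ := 0) (M := (2 * evenSum t : ℕ)) _ (by simp)
    (fun x y h1 h2 => by unfold westQ; omega) (fun x y h1 h2 => by unfold westQ; omega),
    ← hXdef, ← image_orderEmbOfFin_affine hX]
  have h := closed_form_odd (isCellCount_weightedCount w 0 hw') (N := (evenSum t + oddSum t : ℕ))
    (by simp) hv (evenSum t) (by simp) (fun i => 2 * (X.orderEmbOfFin hX i : ℤ) + 1 - 0)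
    (fun i j hij => by
      have := (X.orderEmbOfFin hX).strictMono hij
      simp only
      omega) (fun i => by omega)
    (fun i => by
      have := lt_of_mem_blocks_psum t (orderEmbOfFin_mem X hX i)
      push_cast
      omega) (fun i => by simp)
  rw [show ((2 * evenSum t : ℕ) : ℤ) - 2 * (evenSum t : ℕ) = 0 by push_cast; ring] at h
  -- The dent at `n` is the cell `2 * n + 1`, so the variables are `2 * n + (1 + σ)`; they also
  -- occur as the extra factor of the odd determinant.
  rw [h, det_oddPoly]
  have hx : ∀ i, (((2 * (X.orderEmbOfFin hX i : ℤ) + 1 - 0 : ℤ) : ℚ) + σ) =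
      2 * (X.orderEmbOfFin hX i : ℚ) + (1 + σ) := fun i => by push_cast; ring
  simp only [hx]
  rw [prod_orderEmbOfFin_sq_sub hX, prod_orderEmbOfFin hX fun x => 2 * (x : ℚ) + (1 + σ),
    pairProd_eq_mul fun x => 2 * (x : ℚ) + (1 + σ), ← oddConst_mul]
  ring

/-- The weighted number of tilings of `𝒦(t)`, as a product over the dents. -/
theorem weightedCount_regionK (w : Finset Tri → ℚ) {σ : ℚ}
    (hw : ∀ x y : ℤ, 0 ≤ x → 0 ≤ y → w {(x, y, false), (x, y + 1, true)} = 1)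
    (hw' : ∀ c y, w {cellTri 1 (c, y), cellTri 1 (c + 1, y)} = 1)
    (hv : IsBoundaryWeight (fun c y => w {cellTri 1 (c, y), cellTri 1 (c, y + 1)}) σ 1
      (2 * evenSum t : ℕ)) :
    weightedCount w (regionK t) =
      1 / (hyperSkip (2 * evenSum t) : ℚ) * pairProd (fun _ => 1) σ (blocks (psum t) l) := by
  have hX := card_blocks t
  set X := blocks (psum t) l with hXdef
  -- For `evenSum t = 0` the truncated height `2 * evenSum t - 1` is `0` and the region is empty;
  -- the closed form needs at least one dent.
  rcases Nat.eq_zero_or_pos (evenSum t) with hE | hE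
  · have h0 : X = ∅ := card_eq_zero.1 (hX.trans hE)
    have h1 : regionK t = ∅ := by
      simp [regionK, removeTriangles, trapezoid, hE]
    rw [h1, h0, hE, weightedCount_empty]
    simp [hyperSkip, pairProd]
  · obtain ⟨k, hk⟩ : ∃ k, evenSum t = k + 1 := ⟨evenSum t - 1, by omega⟩
    have hX' : #X = k + 1 := hX.trans hk
    rw [regionK, weightedCount_removeTriangles t w (fun y hy => by unfold westK; omega)
      (by omega) hw, trapezoid_sdiff_eq_image (δ := 1) (M := (2 * evenSum t : ℕ)) _ (by omega)
      (fun x y h1 h2 => by unfold westK; omega) (fun x y h1 h2 => by unfold westK; omega),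
      ← hXdef, ← image_orderEmbOfFin_affine hX']
    have h := closed_form_even (isCellCount_weightedCount w 1 hw')
      (N := (evenSum t + oddSum t : ℕ))
      (by simp) hv k (by omega) (fun i => 2 * (X.orderEmbOfFin hX' i : ℤ) + 1 - 1)
      (fun i j hij => by
        have := (X.orderEmbOfFin hX').strictMono hij
        simp only
        omega) (fun i => by omega)
      (fun i => by
        have := lt_of_mem_blocks_psum t (orderEmbOfFin_mem X hX' i)
        push_cast
        omega) (fun i => by simp)
    -- With the offset `1` the bottom row has index `1`, hence starts with an up-pointing cell, and
    -- the dent at `n` is the cell `2 * n`.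
    rw [show ((2 * evenSum t : ℕ) : ℤ) - 2 * (k : ℕ) - 1 = 1 by omega] at h
    rw [h, det_evenPoly]
    have hx : ∀ i, (((2 * (X.orderEmbOfFin hX' i : ℤ) + 1 - 1 : ℤ) : ℚ) + σ) =
        2 * (X.orderEmbOfFin hX' i : ℚ) + σ := fun i => by push_cast; ring
    simp only [hx]
    rw [prod_orderEmbOfFin_sq_sub hX', hk, ← evenConst_mul]
    ring

end Counts

/-! ### The weights on the western side -/

theorem westWeight_eq_one {west : ℤ → ℤ} {m : ℕ} {p q : Tri}
    (h : ∀ y ∈ Ioo (0 : ℤ) m, west (y - 1) = west y + 1 → west (y + 1) = west y →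
      ((west y, y - 1, false) = p ∨ (west y, y - 1, false) = q) →
      ((west y, y, true) = p ∨ (west y, y, true) = q) → False) :
    westWeight west m {p, q} = 1 := by
  refine if_neg ?_
  rintro ⟨y, hy, h1, h2, he⟩
  refine h y hy h1 h2 ?_ ?_
  · have : (west y, y - 1, false) ∈ ({p, q} : Finset Tri) := by rw [he]; simp
    simpa using this
  · have : (west y, y, true) ∈ ({p, q} : Finset Tri) := by rw [he]; simp
    simpa using this

theorem westWeight_horizontal (west : ℤ → ℤ) (m : ℕ) (δ c y : ℤ) :
    westWeight west m {cellTri δ (c, y), cellTri δ (c + 1, y)} = 1 := by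
  refine westWeight_eq_one fun z _ _ _ h1 h2 => ?_
  simp only [eq_comm (b := cellTri _ _), cellTri_eq_up, cellTri_eq_down] at h1 h2
  omega

theorem isBoundaryWeight_westQ (m : ℕ) :
    IsBoundaryWeight (fun c y => westWeight westQ m {cellTri 0 (c, y), cellTri 0 (c, y + 1)})
      0 0 m := by
  refine isBoundaryWeight_half (fun c y hc => westWeight_eq_one fun z hz h1 h2 h3 h4 => ?_)
    fun y hy hym he => ?_
  · simp only [eq_comm (b := cellTri _ _), cellTri_eq_up, cellTri_eq_down] at h3 h4
    unfold westQ at *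
    omega
  · rw [Int.even_iff] at he
    refine if_pos ⟨y + 1, by rw [mem_Ioo]; omega, by unfold westQ; omega, by unfold westQ; omega,
      ?_⟩
    rw [(cellTri_eq_down (x := westQ (y + 1)) (y' := y)).2 ⟨by unfold westQ; omega, by omega⟩,
      (cellTri_eq_up (x := westQ (y + 1)) (y' := y + 1)).2 ⟨by unfold westQ; omega, by omega⟩,
      add_sub_cancel_right]

theorem isBoundaryWeight_westK (m : ℕ) :
    IsBoundaryWeight (fun c y => westWeight westK (m - 1)
      {cellTri 1 (c, y), cellTri 1 (c, y + 1)}) 0 1 m := by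
  refine isBoundaryWeight_half (fun c y hc => westWeight_eq_one fun z hz h1 h2 h3 h4 => ?_)
    fun y hy hym he => ?_
  · simp only [eq_comm (b := cellTri _ _), cellTri_eq_up, cellTri_eq_down] at h3 h4
    unfold westK at *
    omega
  · rw [Int.even_iff] at he
    refine if_pos ⟨y, by rw [mem_Ioo]; omega, by unfold westK; omega, by unfold westK; omega, ?_⟩
    rw [(cellTri_eq_down (x := westK y) (y' := y - 1)).2 ⟨by unfold westK; omega, by omega⟩,
      (cellTri_eq_up (x := westK y) (y' := y)).2 ⟨by unfold westK; omega, by omega⟩]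

theorem westWeight_westQ_inner (m : ℕ) (x y : ℤ) (hx : 0 ≤ x) (_ : 0 ≤ y) :
    westWeight westQ m {(x, y, false), (x, y + 1, true)} = 1 := by
  refine westWeight_eq_one fun z hz h1 h2 h3 h4 => ?_
  rw [mem_Ioo] at hz
  simp only [Prod.mk.injEq] at h3 h4
  unfold westQ at *
  simp at h3
  omega

/-- The conditions on the zigzag force the height of the western vertex to be even and positive, so
that its first coordinate is negative. -/
theorem westWeight_westK_inner (m : ℕ) (x y : ℤ) (hx : 0 ≤ x) (_ : 0 ≤ y) :
    westWeight westK m {(x, y, false), (x, y + 1, true)} = 1 := by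
  refine westWeight_eq_one fun z hz h1 h2 h3 h4 => ?_
  rw [mem_Ioo] at hz
  simp only [Prod.mk.injEq] at h3 h4
  unfold westK at *
  simp at h3
  omega

/-! ### The four sets of factors -/

theorem hyperSkip_add_two (n : ℕ) : hyperSkip (n + 2) = hyperSkip n * n.factorial := by
  rw [hyperSkip, show (n + 2) / 2 = n / 2 + 1 by omega, show (n + 2) % 2 = n % 2 by omega,
    prod_range_succ, ← hyperSkip, Nat.div_add_mod]

theorem hyperSkip_ne_zero (n : ℕ) : (hyperSkip n : ℚ) ≠ 0 := by
  rw [hyperSkip, Nat.cast_ne_zero, prod_ne_zero_iff]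
  exact fun i _ => Nat.factorial_ne_zero _

theorem cast_factorial_ne_zero (n : ℕ) : (n.factorial : ℚ) ≠ 0 := by
  exact_mod_cast n.factorial_ne_zero

/-- The product of `x + 1` over an interval is a quotient of factorials of its ends, whence the
factorials in `ψ` and `χ`. -/
theorem isProductData_Q : IsProductData (fun x => (x : ℚ) + 1) (fun n => ((n + 1).factorial : ℚ))
    (fun n => (hyper (n + 1) : ℚ)) (fun n => (n.factorial : ℚ) * hyperSkip (2 * n + 1))
    (fun n => 1 / (n.factorial : ℚ) * ((hyper (2 * n + 2) : ℚ) / hyperSkip (2 * n + 3))) 2 where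
  φ_ne_zero n := cast_factorial_ne_zero _
  φ_succ n _ := by
    rw [Nat.factorial_succ (n + 1)]; push_cast; ring
  h_ne_zero n := hyper_ne_zero _
  h_succ n := by rw [hyper_succ (n + 1)]; push_cast; ring
  ψ_succ n := by
    rw [show 2 * (n + 1) + 1 = 2 * n + 1 + 2 by ring, hyperSkip_add_two, Nat.factorial_succ n]
    push_cast
    ring
  ψ_mul_χ n := by
    have h1 := cast_factorial_ne_zero n
    have h2 := cast_factorial_ne_zero (2 * n + 1)
    have h3 := hyperSkip_ne_zero (2 * n + 1)
    rw [show 2 * n + 3 = 2 * n + 1 + 2 by ring, hyperSkip_add_two, hyper_succ (2 * n + 1)]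
    push_cast
    field_simp

theorem isProductData_weightedQ : IsProductData (fun x => 2 * (x : ℚ) + 1)
    (fun n => (n.factorial : ℚ)) (fun n => (hyper n : ℚ)) (fun n => (hyperSkip (2 * n + 1) : ℚ))
    (fun n => (hyper (2 * n) : ℚ) / hyperSkip (2 * n + 1)) 1 where
  φ_ne_zero n := cast_factorial_ne_zero _
  φ_succ n _ := by
    rw [Nat.factorial_succ]; push_cast; ring
  h_ne_zero n := hyper_ne_zero _
  h_succ n := by rw [hyper_succ]; push_cast; ring
  ψ_succ n := by
    rw [show 2 * (n + 1) + 1 = 2 * n + 1 + 2 by ring, hyperSkip_add_two, Nat.factorial_succ]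
    push_cast
    ring
  ψ_mul_χ n := by
    have h3 := hyperSkip_ne_zero (2 * n + 1)
    field_simp

theorem isProductData_K : IsProductData (fun _ => 1)
    (fun n => (n.factorial : ℚ)) (fun n => (hyper n : ℚ)) (fun n => (hyperSkip (2 * n) : ℚ))
    (fun n => (hyper (2 * n + 1) : ℚ) / hyperSkip (2 * n + 2)) 1 where
  φ_ne_zero n := cast_factorial_ne_zero _
  φ_succ n _ := by
    rw [Nat.factorial_succ]; push_cast; ring
  h_ne_zero n := hyper_ne_zero _
  h_succ n := by rw [hyper_succ]; push_cast; ring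
  ψ_succ n := by
    rw [mul_add, mul_one, hyperSkip_add_two]
    push_cast
    ring
  ψ_mul_χ n := by
    have h2 := cast_factorial_ne_zero (2 * n)
    have h3 := hyperSkip_ne_zero (2 * n)
    rw [hyperSkip_add_two, hyper_succ]
    push_cast
    field_simp

theorem hyper_eq_pred_mul (n : ℕ) : hyper n = hyper (n - 1) * (n - 1).factorial := by
  cases n with
  | zero => simp [hyper]
  | succ n => rw [hyper_succ]; rfl

theorem hyperSkip_two_mul_add_one (n : ℕ) :
    hyperSkip (2 * n + 1) = hyperSkip (2 * n - 1) * (2 * n - 1).factorial := by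
  cases n with
  | zero => simp [hyperSkip]
  | succ n =>
    rw [← hyperSkip_add_two]
    rfl

theorem isProductData_weightedK : IsProductData (fun _ => 1)
    (fun n => ((n - 1).factorial : ℚ)) (fun n => (hyper (n - 1) : ℚ))
    (fun n => (hyperSkip (2 * n - 1) : ℚ))
    (fun n => (hyper (2 * n) : ℚ) / hyperSkip (2 * n + 1)) 0 where
  φ_ne_zero n := cast_factorial_ne_zero _
  φ_succ n hn := by
    rw [add_tsub_cancel_right, ← Nat.mul_factorial_pred hn.ne']; push_cast; ring
  h_ne_zero n := hyper_ne_zero _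
  h_succ n := by rw [add_tsub_cancel_right, hyper_eq_pred_mul]; push_cast; ring
  ψ_succ n := by
    rw [show 2 * (n + 1) - 1 = 2 * n + 1 by omega, hyperSkip_two_mul_add_one]
    push_cast
    ring
  ψ_mul_χ n := by
    have h2 := cast_factorial_ne_zero (2 * n - 1)
    have h3 := hyperSkip_ne_zero (2 * n - 1)
    rw [hyperSkip_two_mul_add_one, hyper_eq_pred_mul (2 * n)]
    push_cast
    field_simp

end QuarteredHexagon

open QuarteredHexagon in
/-- In the formula for the weighted `𝒦'(t)` an argument `-1` of one of the two hyperfactorials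
(which occurs only if `t` begins with two zeros) denotes an empty product; this is what the
truncated subtraction gives. -/
theorem mainTheorem6 (l : ℕ) (t : Fin (2 * l) → ℕ) :
    ((tilingsQ t : ℚ) =
      (∏ i ∈ Finset.Icc 1 l,
          ((psum t (2 * i)).factorial : ℚ) / ((psum t (2 * i - 1)).factorial : ℚ)) /
        (hyperSkip (2 * evenSum t + 1) : ℚ) *
      (∏ i ∈ Finset.Icc 1 l,
          (hyperSkip (2 * psum t (2 * i) + 1) : ℚ) * (hyper (2 * psum t (2 * i - 1) + 2) : ℚ) /
            (hyperSkip (2 * psum t (2 * i - 1) + 3) : ℚ)) *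
      (∏ p ∈ oddPairs (2 * l),
          (hyper (psum t p.2 - psum t p.1) : ℚ) / (hyper (psum t p.2 + psum t p.1 + 1) : ℚ)) *
      (∏ p ∈ evenPairs (2 * l),
          (hyper (psum t p.2 + psum t p.1 + 1) : ℚ) / (hyper (psum t p.2 - psum t p.1) : ℚ))) ∧
    (weightedTilingsQ t =
      (1 / 2 : ℚ) ^ evenSum t / (hyperSkip (2 * evenSum t + 1) : ℚ) *
      (∏ i ∈ Finset.Icc 1 l,
          (hyperSkip (2 * psum t (2 * i) + 1) : ℚ) * (hyper (2 * psum t (2 * i - 1)) : ℚ) /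
            (hyperSkip (2 * psum t (2 * i - 1) + 1) : ℚ)) *
      (∏ p ∈ oddPairs (2 * l),
          (hyper (psum t p.2 - psum t p.1) : ℚ) / (hyper (psum t p.2 + psum t p.1) : ℚ)) *
      (∏ p ∈ evenPairs (2 * l),
          (hyper (psum t p.2 + psum t p.1) : ℚ) / (hyper (psum t p.2 - psum t p.1) : ℚ))) ∧
    ((tilingsK t : ℚ) =
      1 / (hyperSkip (2 * evenSum t) : ℚ) *
      (∏ i ∈ Finset.Icc 1 l,
          (hyperSkip (2 * psum t (2 * i)) : ℚ) * (hyper (2 * psum t (2 * i - 1) + 1) : ℚ) /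
            (hyperSkip (2 * psum t (2 * i - 1) + 2) : ℚ)) *
      (∏ p ∈ oddPairs (2 * l),
          (hyper (psum t p.2 - psum t p.1) : ℚ) / (hyper (psum t p.2 + psum t p.1) : ℚ)) *
      (∏ p ∈ evenPairs (2 * l),
          (hyper (psum t p.2 + psum t p.1) : ℚ) / (hyper (psum t p.2 - psum t p.1) : ℚ))) ∧
    (weightedTilingsK t =
      1 / (hyperSkip (2 * evenSum t) : ℚ) *
      (∏ i ∈ Finset.Icc 1 l,
          (hyperSkip (2 * psum t (2 * i) - 1) : ℚ) * (hyper (2 * psum t (2 * i - 1)) : ℚ) /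
            (hyperSkip (2 * psum t (2 * i - 1) + 1) : ℚ)) *
      (∏ p ∈ oddPairs (2 * l),
          (hyper (psum t p.2 - psum t p.1) : ℚ) / (hyper (psum t p.2 + psum t p.1 - 1) : ℚ)) *
      (∏ p ∈ evenPairs (2 * l),
          (hyper (psum t p.2 + psum t p.1 - 1) : ℚ) / (hyper (psum t p.2 - psum t p.1) : ℚ))) := by
  have hs := psum_mono t
  refine ⟨?_, ?_, ?_, ?_⟩
  · have h := weightedCount_regionQ t (fun _ => 1) (fun _ _ _ _ => rfl) (fun _ _ => rfl)
      (isBoundaryWeight_one fun _ _ => rfl)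
    rw [tilingsQ, card_tilings_eq_weightedCount, h, pairProd_eq_mul]
    -- One factor `2` per dent cancels the power of `1 / 2` from `oddConst`; in the weighted count
    -- the factors `2 * x + 1` are odd and the power remains.
    have h2 : ∏ x ∈ blocks (psum t) l, (2 * (x : ℚ) + (1 + 1)) =
        2 ^ evenSum t * ∏ x ∈ blocks (psum t) l, ((x : ℚ) + 1) := by
      rw [← card_blocks t, ← Finset.prod_const, ← Finset.prod_mul_distrib]
      exact Finset.prod_congr rfl fun x _ => by ring
    have h3 : (1 / 2 : ℚ) ^ evenSum t * 2 ^ evenSum t = 1 := by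
      rw [← mul_pow]; norm_num
    have h4 := isProductData_Q.endsProd_eq_pairProd hs l
    rw [pairProd_eq_mul, endsProd] at h4
    have h5 : (1 : ℚ) + 1 = 2 := by norm_num
    rw [h2, h5]
    calc _ = (1 / 2 : ℚ) ^ evenSum t * 2 ^ evenSum t / (hyperSkip (2 * evenSum t + 1) : ℚ) *
          ((∏ x ∈ blocks (psum t) l, ((x : ℚ) + 1)) *
            pairProd (fun _ => 1) 2 (blocks (psum t) l)) := by ring
      _ = _ := by
        rw [h3, ← h4]
        simp only [← mul_assoc, div_eq_mul_inv, Finset.prod_mul_distrib, one_mul]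
        ring
  · rw [weightedTilingsQ, weightedCount_regionQ t _ (westWeight_westQ_inner _)
      (westWeight_horizontal _ _ _) (isBoundaryWeight_westQ _)]
    have h4 := isProductData_weightedQ.endsProd_eq_pairProd hs l
    rw [add_zero, ← h4, endsProd]
    simp only [mul_div_assoc, mul_assoc]
  · have h := weightedCount_regionK t (fun _ => 1) (fun _ _ _ _ => rfl) (fun _ _ => rfl)
      (isBoundaryWeight_one fun _ _ => rfl)
    have h4 := isProductData_K.endsProd_eq_pairProd hs l
    rw [tilingsK, card_tilings_eq_weightedCount, h, ← h4, endsProd]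
    simp only [mul_div_assoc, mul_assoc]
  · rw [weightedTilingsK, weightedCount_regionK t _ (westWeight_westK_inner _)
      (westWeight_horizontal _ _ _) (isBoundaryWeight_westK _)]
    have h4 := isProductData_weightedK.endsProd_eq_pairProd hs l
    rw [← h4, endsProd]
    simp only [mul_div_assoc, mul_assoc]
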